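/- Let $(W,S)$ be a Coxeter system ($W$ and $S$ may be infinite), let $\Gamma$ be a totally ordered abelian group, and let $\varphi : S \to \Gamma$ be a map that takes the same value on any two elements of $S$ that are conjugate in $W$. Let $\mathcal H(W,S,\varphi)$ be the Hecke algebra over $\mathbb Z[\Gamma]=\bigoplus_{\gamma\in\Gamma}\mathbb Z e^{\gamma}$ with basis $(T_w)_{w\in W}$ and relations $T_wT_{w'}=T_{ww'}$ if $\ell(ww')=\ell(w)+\ell(w')$, and $(T_s-e^{\varphi(s)})(T_s+e^{-\varphi(s)})=0$ for $s\in S$. Let $h\mapsto\overline h$ be the ring involution with $\overline{e^\gamma}=e^{-\gamma}$, $\overline{T_w}=T_{w^{-1}}^{-1}$, and let $(C_w)_{w\in W}$ be the Kazhdan–Lusztig basis: $\overline{C_w}=C_w$ and $C_w\equiv T_w$ modulo $\bigoplus_{y}\mathbb Z[\Gamma_{<0}]T_y$. Let $\leqslant_L$ be the transitive closure of the relation "$C_x$ occurs with non-zero coefficient in $hC_y$ for some $h\in\mathcal H(W,S,\varphi)$"; left cells are the classes of the associated equivalence relation. For a left cell $C$ put $M_C=\bigl(\bigoplus_{w\leqslant_L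 C}\mathbb Z[\Gamma]C_w\bigr)/\bigl(\bigoplus_{w\leqslant_L C,\,w\notin C}\mathbb Z[\Gamma]C_w\bigr)$, a left $\mathcal H(W,S,\varphi)$-module, and let $\mathbb Z M_C=\mathbb Z\otimes_{\mathbb Z[\Gamma]}M_C$ (where $\mathbb Z[\Gamma]\to\mathbb Z$, $e^\gamma\mapsto 1$), a module over $\mathbb Z\otimes_{\mathbb Z[\Gamma]}\mathcal H(W,S,\varphi)=\mathbb ZW$. Let $S=I\sqcup J$ be a partition such that no element of $I$ is conjugate in $W$ to an element of $J$, and assume that $\varphi(s)=0$ for all $s\in I$. Let $W_I=\langle I\rangle$, $\tilde J=\{wtw^{-1} : w\in W_I,\ t\in J\}$, $\tilde W=\langle\tilde J\rangle$, and for $\tilde t\in\tilde J$ let $\tilde\varphi(\tilde t)=\varphi(t)$, where $t\in J$ is $W_I$-conjugate to $\tilde t$. Then $(\tilde W,\tilde J)$ is a Coxeter system and $\tilde\varphi$ takes the same value on elements of $\tilde J$ that are conjugate in $\tilde W$. Moreover, if $C$ is a left cell for $(\tilde W,\tilde J,\tilde\varphi)$, then $W_I\cdot C=\{ax : a\in W_I,\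 x\in C\}$ is a left cell for $(W,S,\varphi)$ and there is an isomorphism of $\mathbb ZW$-modules $$\mathbb Z M_{W_I\cdot C}\;\simeq\;\operatorname{Ind}_{\tilde W}^{W}\,\mathbb Z M_C .$$ -/

import Mathlib

open scoped TensorProduct Pointwise

noncomputable section

namespace KLCells

/-! ### The group ring `ℤ[Γ]` -/

section GroupRing

variable (Γ : Type*) [AddCommGroup Γ]

/-- The group ring `ℤ[Γ] = ⨁_γ ℤ e^γ`. -/
abbrev GroupRing : Type _ := AddMonoidAlgebra ℤ Γ

variable {Γ}

/-- The basis element `e^γ` of `ℤ[Γ]`. -/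
def expo (γ : Γ) : GroupRing Γ := AddMonoidAlgebra.single γ 1

variable (Γ)

/-- The involution `e^γ ↦ e^{-γ}` of `ℤ[Γ]`. -/
def barScalar : GroupRing Γ →+* GroupRing Γ :=
  AddMonoidAlgebra.mapDomainRingHom ℤ (negAddMonoidHom : Γ →+ Γ)

/-- The augmentation `ℤ[Γ] → ℤ`, `e^γ ↦ 1`. -/
def aug : GroupRing Γ →+* ℤ :=
  (AddMonoidAlgebra.lift ℤ ℤ Γ 1).toRingHom

/-- The abelian group `ℤ`, seen as a `ℤ[Γ]`-module through the augmentation. -/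
@[nolint unusedArguments]
def AugInt (_ : Type*) : Type := ℤ

instance : AddCommGroup (AugInt Γ) := inferInstanceAs (AddCommGroup ℤ)

instance : Module (GroupRing Γ) (AugInt Γ) := Module.compHom ℤ (aug Γ)

variable {Γ}

theorem expo_mul (a b : Γ) : expo a * expo b = expo (a + b) := by
  simp [expo, AddMonoidAlgebra.single_mul_single]

theorem expo_zero : expo (0 : Γ) = 1 := rfl

theorem barScalar_expo (a : Γ) : barScalar Γ (expo a) = expo (-a) := by
  simp [expo, barScalar]

theorem aug_expo (a : Γ) : aug Γ (expo a) = 1 := by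
  simp [expo, aug]

theorem augInt_smul (a : GroupRing Γ) (n : AugInt Γ) :
    a • n = ((aug Γ a * (show ℤ from n) : ℤ) : AugInt Γ) := rfl

theorem expo_smul_augInt (a : Γ) (n : AugInt Γ) : expo a • n = n := by
  rw [augInt_smul, aug_expo]; exact one_mul (show ℤ from n)

end GroupRing

/-! ### Hecke algebras -/

section Hecke

variable {B W : Type*} [Group W] {M : CoxeterMatrix B} (cs : CoxeterSystem M W)
variable {Γ : Type*} [AddCommGroup Γ] (φ : B → Γ)

/-- `φ` is constant on the sets of simple reflections that are conjugate in `W`, i.e. it is a map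
on the set `S̄` of conjugacy classes of simple reflections. -/
def IsParameter : Prop :=
  ∀ i j : B, IsConj (cs.simple i) (cs.simple j) → φ i = φ j

/-- The defining relations of the Hecke algebra, between the generators `T_w`, `w ∈ W`. -/
inductive HeckeRel : FreeAlgebra (GroupRing Γ) W → FreeAlgebra (GroupRing Γ) W → Prop
  | one : HeckeRel (FreeAlgebra.ι _ 1) 1
  | mul (w w' : W) (h : cs.length (w * w') = cs.length w + cs.length w') :
      HeckeRel (FreeAlgebra.ι _ w * FreeAlgebra.ι _ w') (FreeAlgebra.ι _ (w * w'))
  | quad (i : B) :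
      HeckeRel
        ((FreeAlgebra.ι _ (cs.simple i) - algebraMap (GroupRing Γ) _ (expo (φ i))) *
          (FreeAlgebra.ι _ (cs.simple i) + algebraMap (GroupRing Γ) _ (expo (-φ i)))) 0

/-- The Hecke algebra `H(W, S, φ)`: the `ℤ[Γ]`-algebra given by the generators `T_w` (`w ∈ W`), with
`T_1 = 1`, `T_w T_{w'} = T_{ww'}` if `ℓ(ww') = ℓ(w) + ℓ(w')`, and
`(T_s - e^{φ(s)})(T_s + e^{-φ(s)}) = 0` for `s ∈ S`. For a Coxeter system and a parameter `φ` it is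
a free `ℤ[Γ]`-module with basis `(T_w)`. -/
def Hecke : Type _ := RingQuot (HeckeRel cs φ)

instance : Ring (Hecke cs φ) := inferInstanceAs (Ring (RingQuot (HeckeRel cs φ)))

instance : Algebra (GroupRing Γ) (Hecke cs φ) :=
  inferInstanceAs (Algebra (GroupRing Γ) (RingQuot (HeckeRel cs φ)))

/-- The canonical map onto the Hecke algebra. -/
def heckeMk : FreeAlgebra (GroupRing Γ) W →ₐ[GroupRing Γ] Hecke cs φ :=
  RingQuot.mkAlgHom (GroupRing Γ) (HeckeRel cs φ)

/-- The element `T_w`. -/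
def T (w : W) : Hecke cs φ := heckeMk cs φ (FreeAlgebra.ι _ w)

/-- The image of `e^γ` in the Hecke algebra. -/
abbrev E (γ : Γ) : Hecke cs φ := algebraMap (GroupRing Γ) (Hecke cs φ) (expo γ)

theorem heckeMk_rel {x y : FreeAlgebra (GroupRing Γ) W} (h : HeckeRel cs φ x y) :
    heckeMk cs φ x = heckeMk cs φ y := RingQuot.mkAlgHom_rel _ h

theorem T_one : T cs φ 1 = 1 := by
  simpa [T] using heckeMk_rel cs φ HeckeRel.one

theorem T_mul (w w' : W) (h : cs.length (w * w') = cs.length w + cs.length w') :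
    T cs φ w * T cs φ w' = T cs φ (w * w') := by
  simpa [T] using heckeMk_rel cs φ (HeckeRel.mul w w' h)

theorem T_quad (i : B) :
    (T cs φ (cs.simple i) - E cs φ (φ i)) * (T cs φ (cs.simple i) + E cs φ (-φ i)) = 0 := by
  simpa [T] using heckeMk_rel cs φ (HeckeRel.quad i)

theorem E_mul_neg (γ : Γ) : E cs φ γ * E cs φ (-γ) = 1 := by
  rw [← map_mul, expo_mul, add_neg_cancel, expo_zero, map_one]

theorem E_neg_mul (γ : Γ) : E cs φ (-γ) * E cs φ γ = 1 := by
  rw [← map_mul, expo_mul, neg_add_cancel, expo_zero, map_one]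

theorem E_comm (γ : Γ) (h : Hecke cs φ) : E cs φ γ * h = h * E cs φ γ :=
  Algebra.commutes _ _

theorem T_simple_sq (i : B) : T cs φ (cs.simple i) * T cs φ (cs.simple i) =
    1 + E cs φ (φ i) * T cs φ (cs.simple i) - E cs φ (-φ i) * T cs φ (cs.simple i) := by
  have h := T_quad cs φ i
  rw [sub_mul, mul_add, mul_add, E_mul_neg, ← E_comm] at h
  rw [← sub_eq_zero, ← h]
  abel

theorem isUnit_T_simple (i : B) : IsUnit (T cs φ (cs.simple i)) := by
  have h := T_simple_sq cs φ i
  refine ⟨⟨T cs φ (cs.simple i), T cs φ (cs.simple i) - E cs φ (φ i) + E cs φ (-φ i), ?_, ?_⟩, rfl⟩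
  · rw [mul_add, mul_sub, h, ← E_comm, ← E_comm]; abel
  · rw [add_mul, sub_mul, h]; abel

theorem isUnit_T (w : W) : IsUnit (T cs φ w) := by
  induction hn : cs.length w generalizing w with
  | zero => rw [cs.length_eq_zero_iff.1 hn, T_one]; exact isUnit_one
  | succ n ih =>
    have hw : w ≠ 1 := by rintro rfl; simp at hn
    obtain ⟨i, hi⟩ := cs.exists_leftDescent_of_ne_one hw
    have hi' := cs.isLeftDescent_iff.1 hi
    have hm : T cs φ (cs.simple i) * T cs φ (cs.simple i * w) = T cs φ w := by
      rw [T_mul, cs.simple_mul_simple_cancel_left]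
      rw [cs.simple_mul_simple_cancel_left, cs.length_simple]; omega
    rw [← hm]
    exact (isUnit_T_simple cs φ i).mul (ih _ (by omega))

/-- `T_w` as an invertible element. -/
def TUnit (w : W) : (Hecke cs φ)ˣ := (isUnit_T cs φ w).unit

@[simp] theorem coe_TUnit (w : W) : (TUnit cs φ w : Hecke cs φ) = T cs φ w := rfl

/-- The Hecke algebra as a `ℤ[Γ]`-algebra through `e^γ ↦ e^{-γ}`. -/
@[reducible] def twistedAlgebra : Algebra (GroupRing Γ) (Hecke cs φ) :=
  ((algebraMap (GroupRing Γ) (Hecke cs φ)).comp (barScalar Γ)).toAlgebra'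
    (fun a h => Algebra.commutes (barScalar Γ a) h)

/-- The ring morphism from the free algebra that is `e^γ ↦ e^{-γ}` on scalars and sends the
generator `T_w` to `T_{w⁻¹}⁻¹`. -/
def barFree : FreeAlgebra (GroupRing Γ) W →+* Hecke cs φ :=
  letI := twistedAlgebra cs φ
  (FreeAlgebra.lift (GroupRing Γ)
    (fun w : W => ((TUnit cs φ w⁻¹)⁻¹ : (Hecke cs φ)ˣ).val)).toRingHom

theorem barFree_ι (w : W) : barFree cs φ (FreeAlgebra.ι _ w) =
    ((TUnit cs φ w⁻¹)⁻¹ : (Hecke cs φ)ˣ).val := by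
  let _ := twistedAlgebra cs φ
  exact FreeAlgebra.lift_ι_apply _ _

theorem barFree_algebraMap (a : GroupRing Γ) : barFree cs φ (algebraMap _ _ a) =
    algebraMap (GroupRing Γ) (Hecke cs φ) (barScalar Γ a) :=
  @AlgHom.commutes (GroupRing Γ) _ _ _ _ _ _ (twistedAlgebra cs φ)
    (@FreeAlgebra.lift (GroupRing Γ) W _ (Hecke cs φ) _ (twistedAlgebra cs φ)
      (fun w : W => ((TUnit cs φ w⁻¹)⁻¹ : (Hecke cs φ)ˣ).val)) a

theorem barFree_rel ⦃x y : FreeAlgebra (GroupRing Γ) W⦄ (h : HeckeRel cs φ x y) :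
    barFree cs φ x = barFree cs φ y := by
  cases h with
  | one =>
    rw [barFree_ι, map_one, Units.val_eq_one, inv_eq_one, Units.ext_iff]
    simp [T_one]
  | mul w w' h =>
    rw [map_mul, barFree_ι, barFree_ι, barFree_ι, ← Units.val_mul, ← mul_inv_rev]
    congr 2
    ext
    rw [Units.val_mul, coe_TUnit, coe_TUnit, coe_TUnit, mul_inv_rev]
    apply T_mul
    rw [← mul_inv_rev, cs.length_inv, cs.length_inv, cs.length_inv, h, add_comm]
  | quad i =>
    rw [map_mul, map_sub, map_add, barFree_ι, barFree_algebraMap, barFree_algebraMap, map_zero,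
      barScalar_expo, barScalar_expo, neg_neg, cs.inv_simple]
    have hinv : ((TUnit cs φ (cs.simple i))⁻¹ : (Hecke cs φ)ˣ).val =
        T cs φ (cs.simple i) - E cs φ (φ i) + E cs φ (-φ i) := by
      rw [Units.inv_eq_of_mul_eq_one_right]
      rw [coe_TUnit, mul_add, mul_sub, T_simple_sq, ← E_comm, ← E_comm]; abel
    rw [hinv, ← T_quad cs φ i]
    have h1 : T cs φ (cs.simple i) - E cs φ (φ i) + E cs φ (-φ i) - E cs φ (-φ i) =
      T cs φ (cs.simple i) - E cs φ (φ i) := by abel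
    have h2 : T cs φ (cs.simple i) - E cs φ (φ i) + E cs φ (-φ i) + E cs φ (φ i) =
      T cs φ (cs.simple i) + E cs φ (-φ i) := by abel
    exact congrArg₂ (· * ·) h1 h2

/-- The bar involution of the Hecke algebra: the ring morphism with `e^γ ↦ e^{-γ}` and
`T_w ↦ T_{w⁻¹}⁻¹`. -/
def bar : Hecke cs φ →+* Hecke cs φ :=
  RingQuot.lift ⟨barFree cs φ, barFree_rel cs φ⟩

theorem bar_heckeMk (x : FreeAlgebra (GroupRing Γ) W) :
    bar cs φ (heckeMk cs φ x) = barFree cs φ x := by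
  have h : heckeMk cs φ x = RingQuot.mkRingHom (HeckeRel cs φ) x :=
    congrArg (fun f : _ →+* _ => f x) (RingQuot.mkAlgHom_coe (GroupRing Γ) (HeckeRel cs φ))
  rw [h]
  exact RingQuot.lift_mkRingHom_apply _ _ _

theorem bar_T (w : W) : bar cs φ (T cs φ w) = ((TUnit cs φ w⁻¹)⁻¹ : (Hecke cs φ)ˣ).val := by
  rw [T, bar_heckeMk, barFree_ι]

theorem bar_algebraMap (a : GroupRing Γ) :
    bar cs φ (algebraMap _ _ a) = algebraMap _ _ (barScalar Γ a) := by
  rw [← barFree_algebraMap, ← bar_heckeMk, AlgHom.commutes]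

end Hecke

/-! ### The Kazhdan–Lusztig basis, the left preorder and left cells -/

section Cells

variable {B W : Type*} [Group W] {M : CoxeterMatrix B} (cs : CoxeterSystem M W)
variable {Γ : Type*} [AddCommGroup Γ] [LinearOrder Γ] (φ : B → Γ)

/-- `H_{<0} = ⨁_w ℤ[Γ_{<0}] T_w`. -/
def heckeNeg : AddSubgroup (Hecke cs φ) :=
  AddSubgroup.closure {h | ∃ γ : Γ, γ < 0 ∧ ∃ w : W, h = expo γ • T cs φ w}

/-- `c` is the Kazhdan–Lusztig element attached to `w`: it is fixed by the bar involution and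
congruent to `T_w` modulo `H_{<0}`. -/
def IsKL (w : W) (c : Hecke cs φ) : Prop :=
  bar cs φ c = c ∧ c - T cs φ w ∈ heckeNeg cs φ

open Classical in
/-- The Kazhdan–Lusztig element `C_w`, the unique element with `IsKL cs φ w C_w`. -/
def KL (w : W) : Hecke cs φ :=
  if h : ∃ c, IsKL cs φ w c then h.choose else 0

/-- `x ← y`: for some `h`, the element `C_x` has a non-zero coefficient in the decomposition of
`h C_y` in the basis `(C_z)`. -/
def LeftArrow (x y : W) : Prop :=
  ∃ (h : Hecke cs φ) (a : W →₀ GroupRing Γ),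
    h * KL cs φ y = a.sum (fun z c => c • KL cs φ z) ∧ a x ≠ 0

/-- The left preorder `x ≤_L y`. -/
def LeftLE (x y : W) : Prop := Relation.TransGen (LeftArrow cs φ) x y

/-- `x ∼_L y`. -/
def LeftEquiv (x y : W) : Prop := LeftLE cs φ x y ∧ LeftLE cs φ y x

/-- `C` is a left cell for `(W, S, φ)`. -/
def IsLeftCell (C : Set W) : Prop := ∃ w : W, C = {x | LeftEquiv cs φ x w}

/-- The left ideal `H_{≤ C}`, which is spanned by the `C_w` with `w ≤_L C`. (For a left cell `C`
the `ℤ[Γ]`-span of these elements is already a left ideal, by the definition of `≤_L`.) -/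
def idealLE (C : Set W) : Submodule (Hecke cs φ) (Hecke cs φ) :=
  Submodule.span _ {h | ∃ w : W, (∃ c ∈ C, LeftLE cs φ w c) ∧ h = KL cs φ w}

/-- The left ideal `H_{< C}`, which is spanned by the `C_w` with `w ≤_L C` and `w ∉ C`. (For a left
cell `C` the `ℤ[Γ]`-span of these elements is already a left ideal, by the definition of `≤_L`.) -/
def idealLT (C : Set W) : Submodule (Hecke cs φ) (Hecke cs φ) :=
  Submodule.span _ {h | ∃ w : W, ((∃ c ∈ C, LeftLE cs φ w c) ∧ w ∉ C) ∧ h = KL cs φ w}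

/-- The left `H`-module `M_C = H_{≤ C} / H_{< C}`. -/
abbrev CellModule (C : Set W) : Type _ :=
  idealLE cs φ C ⧸ (idealLT cs φ C).submoduleOf (idealLE cs φ C)

end Cells

/-! ### Specialisation at `e^γ ↦ 1` -/

section Specialisation

variable {B W : Type*} [Group W] {M : CoxeterMatrix B} (cs : CoxeterSystem M W)
variable {Γ : Type*} [AddCommGroup Γ] (φ : B → Γ)
variable (V : Type*) [AddCommGroup V] [Module (GroupRing Γ) V] [Module (Hecke cs φ) V]
  [IsScalarTower (GroupRing Γ) (Hecke cs φ) V]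

/-- Multiplication by `h ∈ H` on `ℤ ⊗_{ℤ[Γ]} V`. -/
def specAct (h : Hecke cs φ) : Module.End ℤ (AugInt Γ ⊗[GroupRing Γ] V) :=
  (LinearMap.lTensor (AugInt Γ)
    (Algebra.lsmul (GroupRing Γ) (GroupRing Γ) V h)).toAddMonoidHom.toIntLinearMap

@[simp] theorem specAct_tmul (h : Hecke cs φ) (n : AugInt Γ) (v : V) :
    specAct cs φ V h (n ⊗ₜ v) = n ⊗ₜ (h • v) := rfl

variable {V} in
theorem specEnd_ext {f g : Module.End ℤ (AugInt Γ ⊗[GroupRing Γ] V)}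
    (h : ∀ n v, f (n ⊗ₜ v) = g (n ⊗ₜ v)) : f = g := by
  ext x
  induction x with
  | zero => simp
  | tmul n v => exact h n v
  | add x y hx hy => rw [map_add, map_add, hx, hy]

theorem specAct_one : specAct cs φ V 1 = 1 := specEnd_ext (by simp)

theorem specAct_mul (h h' : Hecke cs φ) :
    specAct cs φ V (h * h') = specAct cs φ V h * specAct cs φ V h' :=
  specEnd_ext (by simp [mul_smul])

theorem specAct_simple_sq (i : B) :
    specAct cs φ V (T cs φ (cs.simple i)) * specAct cs φ V (T cs φ (cs.simple i)) = 1 := by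
  rw [← specAct_mul, T_simple_sq]
  refine specEnd_ext fun n v => ?_
  rw [specAct_tmul, sub_smul, add_smul, TensorProduct.tmul_sub, TensorProduct.tmul_add, one_smul,
    mul_smul, mul_smul, algebraMap_smul, algebraMap_smul, ← TensorProduct.smul_tmul (expo (φ i)),
    ← TensorProduct.smul_tmul (expo (-φ i)), expo_smul_augInt, expo_smul_augInt]
  simp

theorem specAct_simple_mul (i : B) (w : W) :
    specAct cs φ V (T cs φ (cs.simple i * w)) =
      specAct cs φ V (T cs φ (cs.simple i)) * specAct cs φ V (T cs φ w) := by
  rcases cs.length_simple_mul w i with h | h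
  · rw [← specAct_mul, T_mul]
    rw [h, cs.length_simple, add_comm]
  · have : T cs φ w = T cs φ (cs.simple i) * T cs φ (cs.simple i * w) := by
      rw [T_mul, cs.simple_mul_simple_cancel_left]
      rw [cs.simple_mul_simple_cancel_left, cs.length_simple]; omega
    rw [this, specAct_mul, ← mul_assoc, specAct_simple_sq, one_mul]

theorem specAct_T_mul (w w' : W) : specAct cs φ V (T cs φ (w * w')) =
    specAct cs φ V (T cs φ w) * specAct cs φ V (T cs φ w') := by
  induction w using cs.simple_induction_left with
  | one => rw [one_mul, T_one, specAct_one, one_mul]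
  | mul_simple_left w i ih => rw [mul_assoc, specAct_simple_mul, ih, specAct_simple_mul, mul_assoc]

/-- The `ℤW`-module `ℤ ⊗_{ℤ[Γ]} V` of an `H`-module `V`; the identification of
`ℤ ⊗_{ℤ[Γ]} H` with `ℤW` sends `1 ⊗ T_w` to `w`, so `w ∈ W` acts as `T_w`. -/
def specRep : Representation ℤ W (AugInt Γ ⊗[GroupRing Γ] V) where
  toFun w := specAct cs φ V (T cs φ w)
  map_one' := by rw [T_one, specAct_one]
  map_mul' := specAct_T_mul cs φ V

end Specialisation

section CellRep

variable {B W : Type*} [Group W] {M : CoxeterMatrix B} (cs : CoxeterSystem M W)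
variable {Γ : Type*} [AddCommGroup Γ] [LinearOrder Γ] (φ : B → Γ)

/-- The `ℤW`-module `ℤ M_C = ℤ ⊗_{ℤ[Γ]} M_C` of a left cell `C`. -/
def cellRep (C : Set W) : Representation ℤ W (AugInt Γ ⊗[GroupRing Γ] CellModule cs φ C) :=
  specRep cs φ (CellModule cs φ C)

end CellRep

/-! ### Zero values of the parameter -/

section Zero

variable {B W : Type*} [Group W] {M : CoxeterMatrix B} (cs : CoxeterSystem M W) (I : Set B)

/-- The parabolic subgroup `W_I`. -/
def parabolic : Subgroup W := Subgroup.closure (cs.simple '' I)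

/-- `J̃ = {w t w⁻¹ | w ∈ W_I, t ∈ J}`, where `J` is the complement of `I`. -/
def tildeJ : Set W :=
  {t | ∃ j : B, j ∉ I ∧ ∃ w ∈ parabolic cs I, t = w * cs.simple j * w⁻¹}

/-- `W̃`, the subgroup generated by `J̃`. -/
def tildeW : Subgroup W := Subgroup.closure (tildeJ cs I)

theorem tildeJ_mem (t : tildeJ cs I) :
    ∃ j : B, j ∉ I ∧ ∃ w ∈ parabolic cs I, (t : W) = w * cs.simple j * w⁻¹ := t.2

variable {Γ : Type*} (φ : B → Γ)

/-- `φ̃ : J̃ → Γ`, `φ̃(t̃) = φ(t)` where `t ∈ J` is `W_I`-conjugate to `t̃`. -/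
def tildePhi (t : tildeJ cs I) : Γ := φ (tildeJ_mem cs I t).choose

/-- `φ̃` does not depend on the choice made. -/
theorem tildePhi_eq (hφ : IsParameter cs φ) (t : tildeJ cs I) (j : B) (w : W)
    (ht : (t : W) = w * cs.simple j * w⁻¹) : tildePhi cs I φ t = φ j := by
  obtain ⟨-, v, -, hv⟩ := (tildeJ_mem cs I t).choose_spec
  refine hφ _ _ (isConj_iff.2 ⟨w⁻¹ * v, ?_⟩)
  have h2 := hv.symm.trans ht
  generalize (tildeJ_mem cs I t).choose = k at h2 ⊢
  calc w⁻¹ * v * cs.simple k * (w⁻¹ * v)⁻¹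
      = w⁻¹ * (v * cs.simple k * v⁻¹) * w := by group
    _ = cs.simple j := by rw [h2]; group

end Zero

end KLCells

end

/-!
When `φ` vanishes on `I`, we have `T_s² = 1` for `s ∈ I`, so `T_a T_w = T_{aw}` for `a ∈ W_I` and
all `w`: the Hecke algebra contains the group ring of `W_I`. Since no element of `I` is conjugate
to an element of `J`, the order of `st` is even or infinite for `s ∈ I`, `t ∈ J`, so the Coxeter
relations present `W` as a semidirect product `W_I ⋉ W̃`, where `W̃` has a Coxeter presentation on
`J̃`. The length of `x ∈ W̃` with respect to `J̃` is the number of letters outside `I` in a reduced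
word for `x`, and this makes `T_x ↦ T_x` a morphism `H̃ → H` of Hecke algebras that commutes with
the bar involutions. By uniqueness of the Kazhdan–Lusztig elements, `C_{ax} = T_a C_x` for
`a ∈ W_I` and `x ∈ W̃`. Hence `ax ≤_L by` if and only if `x ≤_L y`, and the classes `a ⊗ C_x` of
the induced module correspond to the basis `C_{ax}` of `ℤ M_{W_I · C}`.
-/

noncomputable section

namespace KLCells

section Exchange

variable {B W : Type*} [Group W] {M : CoxeterMatrix B} (cs : CoxeterSystem M W)

open CoxeterSystem (alternatingWord)

open Classical in
/-- The action of a simple reflection `s` on `W × ℤ/2`: conjugation by `s` on the first component,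
and a change of sign at `s`. Restricted to reflections it is the action of `W` on signed
reflections; allowing all of `W` changes nothing and avoids a subtype. -/
def signedConj (i : B) : Function.End (W × ZMod 2) := fun p =>
  (cs.simple i * p.1 * cs.simple i, p.2 + if p.1 = cs.simple i then 1 else 0)

open Classical in
theorem prod_signedConj_reverse_apply (ω : List B) (t : W) (ε : ZMod 2) :
    (ω.reverse.map (signedConj cs)).prod (t, ε) =
      ((cs.wordProd ω)⁻¹ * t * cs.wordProd ω, ε + ((cs.leftInvSeq ω).count t : ℕ)) := by
  induction ω using List.reverseRecOn with
  | nil => simp [Function.End.one_def]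
  | append_singleton ω i ih =>
    have hfix : (cs.wordProd ω)⁻¹ * t * cs.wordProd ω = cs.simple i ↔
        cs.wordProd ω * cs.simple i * (cs.wordProd ω)⁻¹ = t := by
      rw [mul_assoc, inv_mul_eq_iff_eq_mul, mul_inv_eq_iff_eq_mul, eq_comm]
    rw [← List.concat_eq_append, cs.leftInvSeq_concat, cs.wordProd_concat, List.concat_eq_append,
      List.reverse_concat, List.map_cons, List.prod_cons]
    change signedConj cs i ((ω.reverse.map (signedConj cs)).prod (t, ε)) = _
    simp only [ih, signedConj, hfix, List.concat_eq_append, List.count_append,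
      List.count_singleton, beq_iff_eq, mul_inv_rev, cs.inv_simple, Nat.cast_add, Nat.cast_ite,
      Nat.cast_one, Nat.cast_zero, add_assoc]
    simp only [mul_assoc]

theorem prod_map_reverse_alternatingWord {G : Type*} [Monoid G] (f : B → G) (i j : B) (m : ℕ) :
    ((alternatingWord j i (2 * m)).reverse.map f).prod = (f i * f j) ^ m := by
  induction m with
  | zero => simp [alternatingWord]
  | succ m ih =>
    rw [mul_add_one, CoxeterSystem.alternatingWord_succ, CoxeterSystem.alternatingWord_succ,
      pow_succ', ← ih]
    simp [mul_assoc]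

theorem exists_leftInvSeq_alternatingWord_eq_append_self (i j : B) :
    ∃ l, cs.leftInvSeq (alternatingWord i j (2 * M i j)) = l ++ l := by
  set L := cs.leftInvSeq (alternatingWord i j (2 * M i j)) with hL
  have hlen : L.length = 2 * M i j := by
    rw [hL, cs.length_leftInvSeq, CoxeterSystem.length_alternatingWord]
  have hget (k : ℕ) (hk : k < L.length) : L[k] = cs.simple i * (cs.simple j * cs.simple i) ^ k := by
    simp only [hL, cs.getElem_leftInvSeq_alternatingWord i j _ k (hlen ▸ hk),
      cs.prod_alternatingWord_eq_mul_pow, Nat.even_add_one, even_two_mul, not_true, if_false]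
    congr 2
    omega
  refine ⟨L.take (M i j), List.ext_getElem (by simp [hlen]; omega) fun k hk hk' => ?_⟩
  rw [List.getElem_append, hget k hk]
  split_ifs with h
  · rw [List.getElem_take, hget]
  · simp only [List.length_take, hlen, not_lt] at h
    obtain ⟨k, rfl⟩ := exists_add_of_le ((le_min le_rfl (by omega)).trans h)
    rw [List.getElem_take, hget, pow_add, cs.simple_mul_simple_pow', one_mul]
    simp [hlen, two_mul]

theorem isLiftable_signedConj : M.IsLiftable (signedConj cs) := by
  classical
  intro i j
  obtain ⟨l, hl⟩ := exists_leftInvSeq_alternatingWord_eq_append_self cs j i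
  have hprod : cs.wordProd (alternatingWord j i (2 * M j i)) = 1 := by
    simp [cs.prod_alternatingWord_eq_mul_pow]
  funext ⟨t, ε⟩
  rw [← prod_map_reverse_alternatingWord, M.symmetric, prod_signedConj_reverse_apply, hl, hprod]
  simp [CharTwo.add_self_eq_zero, Function.End.one_def]

/-- The action of `W` on `W × ℤ/2` in which the simple reflections act by `signedConj`. -/
def signedConjHom : W →* Function.End (W × ZMod 2) :=
  cs.lift ⟨signedConj cs, isLiftable_signedConj cs⟩

open Classical in
theorem signedConjHom_inv_wordProd_apply_snd (ω : List B) (t : W) (ε : ZMod 2) :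
    (signedConjHom cs (cs.wordProd ω)⁻¹ (t, ε)).2 = ε + ((cs.leftInvSeq ω).count t : ℕ) := by
  have hsimple : signedConjHom cs ∘ cs.simple = signedConj cs :=
    funext (cs.lift_apply_simple (isLiftable_signedConj cs))
  rw [← cs.wordProd_reverse, CoxeterSystem.wordProd, map_list_prod, List.map_map, hsimple,
    prod_signedConj_reverse_apply]

open Classical in
theorem count_leftInvSeq_eq_of_wordProd_eq {ω ω' : List B} (h : cs.wordProd ω = cs.wordProd ω')
    (t : W) : ((cs.leftInvSeq ω).count t : ZMod 2) = (cs.leftInvSeq ω').count t := by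
  simpa only [signedConjHom_inv_wordProd_apply_snd, zero_add] using
    congrArg (fun w : W => (signedConjHom cs w⁻¹ (t, 0)).2) h

theorem simple_mem_leftInvSeq_of_isLeftDescent {i : B} {ω : List B}
    (h : cs.IsLeftDescent (cs.wordProd ω) i) : cs.simple i ∈ cs.leftInvSeq ω := by
  classical
  obtain ⟨ω', hω', hprod⟩ := cs.exists_isReduced (cs.simple i * cs.wordProd ω)
  have hcons : cs.wordProd ω = cs.wordProd (i :: ω') := by
    rw [cs.wordProd_cons, ← hprod, cs.simple_mul_simple_cancel_left]
  have hred : cs.IsReduced (i :: ω') := by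
    rw [CoxeterSystem.IsReduced, ← hcons, List.length_cons, ← hω'.eq, ← hprod,
      cs.isLeftDescent_iff.1 h]
  have hcount := count_leftInvSeq_eq_of_wordProd_eq cs hcons (cs.simple i)
  rw [List.count_eq_one_of_mem hred.nodup_leftInvSeq List.mem_cons_self] at hcount
  by_contra hnot
  simp [List.count_eq_zero_of_not_mem hnot] at hcount

theorem exists_exchange {i : B} {ω : List B} (h : cs.IsLeftDescent (cs.wordProd ω) i) :
    ∃ (ω₁ : List B) (k : B) (ω₂ : List B), ω = ω₁ ++ k :: ω₂ ∧
      cs.simple i = cs.wordProd ω₁ * cs.simple k * (cs.wordProd ω₁)⁻¹ ∧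
      cs.simple i * cs.wordProd ω = cs.wordProd (ω₁ ++ ω₂) := by
  obtain ⟨n, hn, hi⟩ := List.mem_iff_getElem.1 (simple_mem_leftInvSeq_of_isLeftDescent cs h)
  rw [cs.length_leftInvSeq] at hn
  rw [cs.getElem_leftInvSeq ω n hn] at hi
  have hω : ω = ω.take n ++ ω[n] :: ω.drop (n + 1) := by simp
  refine ⟨ω.take n, ω[n], ω.drop (n + 1), hω, hi.symm, ?_⟩
  conv_lhs => rw [hω]
  simp only [← hi, cs.wordProd_append, cs.wordProd_cons, inv_mul_cancel_left, mul_assoc,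
    cs.simple_mul_simple_cancel_left]

theorem simple_mul_eq_mul_simple {w : W} {i j : B} (hi : ¬ cs.IsLeftDescent w i)
    (hij : cs.IsLeftDescent (w * cs.simple j) i) : cs.simple i * w = w * cs.simple j := by
  obtain ⟨ω, hω, rfl⟩ := cs.exists_isReduced w
  rw [← cs.wordProd_concat, List.concat_eq_append] at hij
  obtain ⟨ω₁, k, ω₂, hsplit, -, hexch⟩ := exists_exchange cs hij
  rw [cs.wordProd_append, cs.wordProd_singleton, ← mul_assoc] at hexch
  obtain rfl | ⟨ω₃, l, rfl⟩ := List.eq_nil_or_concat' ω₂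
  · obtain ⟨rfl, -⟩ := List.append_inj' hsplit rfl
    rw [List.append_nil] at hexch
    rw [← mul_inv_eq_iff_eq_mul, cs.inv_simple, hexch]
  -- Otherwise the omitted letter lies in `ω`, and omitting it from `ω` shows that `i` is a descent.
  · rw [← List.cons_append, ← List.append_assoc] at hsplit
    obtain ⟨rfl, hlast⟩ := List.append_inj' hsplit rfl
    obtain rfl : j = l := List.singleton_inj.1 hlast
    rw [← List.append_assoc, cs.wordProd_append _ [j], cs.wordProd_singleton, mul_left_inj]
      at hexch
    refine absurd ?_ hi
    have hle := cs.length_wordProd_le (ω₁ ++ ω₃)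
    rw [CoxeterSystem.IsLeftDescent, hexch, hω.eq]
    simp only [List.length_append, List.length_cons] at hle ⊢
    omega

theorem isLeftDescent_mul_simple_iff {w : W} {i j : B} (h : cs.simple i * w ≠ w * cs.simple j) :
    cs.IsLeftDescent (w * cs.simple j) i ↔ cs.IsLeftDescent w i := by
  refine ⟨fun hdesc => by_contra fun hi => h (simple_mul_eq_mul_simple cs hi hdesc),
    fun hdesc => by_contra fun hi => h ?_⟩
  have := simple_mul_eq_mul_simple cs (j := j) hi (by rwa [cs.simple_mul_simple_cancel_right])
  rw [← mul_assoc, cs.simple_mul_simple_cancel_right] at this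
  rw [← mul_inv_eq_iff_eq_mul, cs.inv_simple, this]

theorem isRightDescent_simple_mul_iff {w : W} {i j : B} (h : cs.simple i * w ≠ w * cs.simple j) :
    cs.IsRightDescent (cs.simple i * w) j ↔ cs.IsRightDescent w j := by
  have hinv : cs.simple j * w⁻¹ ≠ w⁻¹ * cs.simple i := fun hc =>
    h (by simpa using congrArg (·⁻¹) hc.symm)
  rw [← cs.isLeftDescent_inv_iff, mul_inv_rev, cs.inv_simple, isLeftDescent_mul_simple_iff cs hinv,
    cs.isLeftDescent_inv_iff]

end Exchange

section AscentInduction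

variable {B W : Type*} [Group W] {M : CoxeterMatrix B} (cs : CoxeterSystem M W)

theorem ascent_induction_left {p : W → Prop} (one : p 1)
    (simple_mul : ∀ i w, ¬ cs.IsLeftDescent w i → p w → p (cs.simple i * w)) (w : W) : p w := by
  induction hn : cs.length w generalizing w with
  | zero => rwa [cs.length_eq_zero_iff.1 hn]
  | succ n ih =>
    obtain ⟨i, hi⟩ := cs.exists_leftDescent_of_ne_one (w := w) (by rintro rfl; simp at hn)
    have := simple_mul i _ (cs.isLeftDescent_iff_not_isLeftDescent_mul.1 hi)
      (ih _ (by have := cs.isLeftDescent_iff.1 hi; omega))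
    rwa [cs.simple_mul_simple_cancel_left] at this

theorem ascent_induction_right {p : W → Prop} (one : p 1)
    (mul_simple : ∀ w i, ¬ cs.IsRightDescent w i → p w → p (w * cs.simple i)) (w : W) : p w := by
  rw [← inv_inv w]
  induction w⁻¹ using ascent_induction_left cs with
  | one => rwa [inv_one]
  | simple_mul i w hi ih =>
    rw [mul_inv_rev, cs.inv_simple]
    exact mul_simple _ _ (by rwa [cs.isRightDescent_inv_iff]) ih

theorem length_mul_of_length_simple_mul_mul {i : B} {u v : W} (hi : ¬ cs.IsLeftDescent u i)
    (h : cs.length (cs.simple i * u * v) = cs.length (cs.simple i * u) + cs.length v) :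
    cs.length (u * v) = cs.length u + cs.length v ∧ ¬ cs.IsLeftDescent (u * v) i := by
  have hle := cs.length_mul_le u v
  rw [cs.not_isLeftDescent_iff] at hi ⊢
  have := cs.length_simple_mul (u * v) i
  rw [← mul_assoc] at this ⊢
  omega

end AscentInduction

section HeckeAlgebra

variable {B W : Type*} [Group W] {M : CoxeterMatrix B} (cs : CoxeterSystem M W)
variable {Γ : Type*} [AddCommGroup Γ] (φ : B → Γ)

/-- The coefficient `e^{φ(s)} - e^{-φ(s)}` of the quadratic relation of `T_s`. -/
def heckeCoeff (i : B) : GroupRing Γ := expo (φ i) - expo (-φ i)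

/-- A family `(f_w)` in a `ℤ[Γ]`-algebra that satisfies the defining relations of the `T_w`. The
multiplication rule is only imposed for left multiplication by a simple reflection, and the
quadratic relation is expanded to `f_s² = 1 + (e^{φ(s)} - e^{-φ(s)}) f_s`. -/
structure IsHeckeFamily {A : Type*} [Ring A] [Algebra (GroupRing Γ) A] (f : W → A) : Prop where
  map_one : f 1 = 1
  map_simple_mul : ∀ i w, ¬ cs.IsLeftDescent w i → f (cs.simple i) * f w = f (cs.simple i * w)
  map_simple_sq : ∀ i, f (cs.simple i) * f (cs.simple i) = 1 + heckeCoeff φ i • f (cs.simple i)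

section UniversalProperty

theorem sub_algebraMap_mul_add_algebraMap_eq_zero {R A : Type*} [CommRing R] [Ring A] [Algebra R A]
    {x : A} {a b : R} (hx : x * x = 1 + (a - b) • x) (hab : a * b = 1) :
    (x - algebraMap R A a) * (x + algebraMap R A b) = 0 := by
  rw [sub_mul, mul_add, hx, mul_add, ← map_mul, hab, map_one, ← Algebra.commutes, sub_smul,
    Algebra.smul_def, Algebra.smul_def]
  abel

variable {cs φ} {A : Type*} [Ring A] [Algebra (GroupRing Γ) A] {f : W → A}

theorem IsHeckeFamily.map_mul (hf : IsHeckeFamily cs φ f) {w w' : W}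
    (h : cs.length (w * w') = cs.length w + cs.length w') : f w * f w' = f (w * w') := by
  induction w using ascent_induction_left cs with
  | one => rw [hf.map_one, one_mul, one_mul]
  | simple_mul i u hi ih =>
    obtain ⟨huw', hi'⟩ := length_mul_of_length_simple_mul_mul cs hi h
    rw [← hf.map_simple_mul i u hi, mul_assoc, ih huw', hf.map_simple_mul i _ hi', mul_assoc]

/-- The algebra morphism `T_w ↦ f_w` from the Hecke algebra. -/
def heckeLift (hf : IsHeckeFamily cs φ f) : Hecke cs φ →ₐ[GroupRing Γ] A :=
  RingQuot.liftAlgHom (GroupRing Γ) ⟨FreeAlgebra.lift (GroupRing Γ) f, fun x y h => by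
    cases h with
    | one => rw [FreeAlgebra.lift_ι_apply, map_one, hf.map_one]
    | mul w w' h => simp only [map_mul, FreeAlgebra.lift_ι_apply, hf.map_mul h]
    | quad i =>
      simp only [map_mul, map_sub, map_add, map_zero, FreeAlgebra.lift_ι_apply, AlgHom.commutes]
      exact sub_algebraMap_mul_add_algebraMap_eq_zero (hf.map_simple_sq i)
        (by rw [expo_mul, add_neg_cancel, expo_zero])⟩

@[simp]
theorem heckeLift_T (hf : IsHeckeFamily cs φ f) (w : W) : heckeLift hf (T cs φ w) = f w :=
  (RingQuot.liftAlgHom_mkAlgHom_apply _ _ _ _).trans (FreeAlgebra.lift_ι_apply _ _)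

end UniversalProperty

section Spanning

open Classical in
theorem T_simple_mul (i : B) (w : W) : T cs φ (cs.simple i) * T cs φ w =
    T cs φ (cs.simple i * w) +
      (if cs.IsLeftDescent w i then heckeCoeff φ i else 0) • T cs φ w := by
  split_ifs with h
  · have hw : T cs φ w = T cs φ (cs.simple i) * T cs φ (cs.simple i * w) := by
      rw [T_mul, cs.simple_mul_simple_cancel_left]
      rw [cs.simple_mul_simple_cancel_left, cs.length_simple, ← cs.isLeftDescent_iff.1 h, add_comm]
    conv_lhs => rw [hw, ← mul_assoc, T_simple_sq]
    rw [sub_mul, add_mul, one_mul, mul_assoc, mul_assoc, ← hw, heckeCoeff, sub_smul,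
      Algebra.smul_def, Algebra.smul_def, add_sub_assoc]
  · rw [zero_smul, add_zero, T_mul]
    rw [cs.not_isLeftDescent_iff.1 h, cs.length_simple, add_comm]

theorem isHeckeFamily_T : IsHeckeFamily cs φ (T cs φ) where
  map_one := T_one cs φ
  map_simple_mul i w h := by rw [T_simple_mul, if_neg h, zero_smul, add_zero]
  map_simple_sq i := by
    have h : cs.IsLeftDescent (cs.simple i) i := by simp [CoxeterSystem.IsLeftDescent]
    rw [T_simple_mul, if_pos h, cs.simple_mul_simple_self, T_one]

theorem T_mul_mem_span_range_T (w : W) {h : Hecke cs φ}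
    (hh : h ∈ Submodule.span (GroupRing Γ) (Set.range (T cs φ))) :
    T cs φ w * h ∈ Submodule.span (GroupRing Γ) (Set.range (T cs φ)) := by
  classical
  induction w using ascent_induction_left cs with
  | one => rwa [T_one, one_mul]
  | simple_mul i w hi ih =>
    rw [← (isHeckeFamily_T cs φ).map_simple_mul i w hi, mul_assoc]
    have hcomap : Submodule.span (GroupRing Γ) (Set.range (T cs φ)) ≤
        (Submodule.span (GroupRing Γ) (Set.range (T cs φ))).comap
          (LinearMap.mulLeft (GroupRing Γ) (T cs φ (cs.simple i))) := by
      refine Submodule.span_le.2 ?_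
      rintro _ ⟨u, rfl⟩
      rw [SetLike.mem_coe, Submodule.mem_comap, LinearMap.mulLeft_apply, T_simple_mul]
      exact add_mem (Submodule.subset_span ⟨_, rfl⟩)
        (Submodule.smul_mem _ _ (Submodule.subset_span ⟨_, rfl⟩))
    exact hcomap ih

theorem adjoin_range_T : Algebra.adjoin (GroupRing Γ) (Set.range (T cs φ)) = ⊤ := by
  have hT : T cs φ = heckeMk cs φ ∘ FreeAlgebra.ι (GroupRing Γ) := rfl
  rw [hT, Set.range_comp, ← AlgHom.map_adjoin, FreeAlgebra.adjoin_range_ι, Algebra.map_top,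
    AlgHom.range_eq_top]
  exact RingQuot.mkAlgHom_surjective _ _

theorem span_range_T : Submodule.span (GroupRing Γ) (Set.range (T cs φ)) = ⊤ := by
  rw [eq_top_iff, ← Algebra.top_toSubmodule, ← adjoin_range_T, Algebra.adjoin_eq_span]
  refine Submodule.span_le.2 fun h hh => ?_
  induction hh using Submonoid.closure_induction_left with
  | one => exact T_one cs φ ▸ Submodule.subset_span ⟨1, rfl⟩
  | mul_left x hx y _ ih =>
    obtain ⟨w, rfl⟩ := hx
    exact T_mul_mem_span_range_T cs φ w ih

variable {cs φ} in
theorem hecke_induction {p : Hecke cs φ → Prop} (T : ∀ w, p (T cs φ w))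
    (add : ∀ x y, p x → p y → p (x + y)) (smul : ∀ (a : GroupRing Γ) x, p x → p (a • x))
    (h : Hecke cs φ) : p h := by
  have hh : h ∈ Submodule.span (GroupRing Γ) (Set.range (KLCells.T cs φ)) :=
    span_range_T cs φ ▸ Submodule.mem_top
  induction hh using Submodule.span_induction with
  | mem x hx => obtain ⟨w, rfl⟩ := hx; exact T w
  | zero => simpa using smul 0 _ (T 1)
  | add x y _ _ hx hy => exact add x y hx hy
  | smul a x _ hx => exact smul a x hx

end Spanning

section RegularRepresentation

open Classical in
/-- Left multiplication by `T_s` on the free module with basis `W`. -/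
def leftOp (i : B) : Module.End (GroupRing Γ) (W →₀ GroupRing Γ) :=
  Finsupp.linearCombination (GroupRing Γ) fun w =>
    Finsupp.single (cs.simple i * w) 1 +
      (if cs.IsLeftDescent w i then heckeCoeff φ i else 0) • Finsupp.single w 1

open Classical in
/-- Right multiplication by `T_s` on the free module with basis `W`. -/
def rightOp (i : B) : Module.End (GroupRing Γ) (W →₀ GroupRing Γ) :=
  Finsupp.linearCombination (GroupRing Γ) fun w =>
    Finsupp.single (w * cs.simple i) 1 +
      (if cs.IsRightDescent w i then heckeCoeff φ i else 0) • Finsupp.single w 1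

open Classical in
theorem leftOp_single (i : B) (w : W) : leftOp cs φ i (Finsupp.single w 1) =
    Finsupp.single (cs.simple i * w) 1 +
      (if cs.IsLeftDescent w i then heckeCoeff φ i else 0) • Finsupp.single w 1 := by
  rw [leftOp, Finsupp.linearCombination_single, one_smul]

open Classical in
theorem rightOp_single (i : B) (w : W) : rightOp cs φ i (Finsupp.single w 1) =
    Finsupp.single (w * cs.simple i) 1 +
      (if cs.IsRightDescent w i then heckeCoeff φ i else 0) • Finsupp.single w 1 := by
  rw [rightOp, Finsupp.linearCombination_single, one_smul]

variable {φ}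

theorem commute_leftOp_rightOp (hφ : IsParameter cs φ) (i j : B) :
    Commute (leftOp cs φ i) (rightOp cs φ j) := by
  classical
  refine Finsupp.lhom_ext' fun w => LinearMap.ext_ring ?_
  simp only [LinearMap.comp_apply, Finsupp.lsingle_apply, Module.End.mul_apply, leftOp_single,
    rightOp_single, map_add, map_smul, mul_assoc]
  by_cases h : cs.simple i * w = w * cs.simple j
  · have hcoeff : heckeCoeff φ i = heckeCoeff φ j := by
      have hconj : IsConj (cs.simple j) (cs.simple i) :=
        isConj_iff.2 ⟨w, by rw [← h, mul_inv_cancel_right]⟩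
      rw [heckeCoeff, heckeCoeff, hφ j i hconj]
    have hw : cs.IsLeftDescent w i ↔ cs.IsRightDescent w j := by
      rw [CoxeterSystem.IsLeftDescent, CoxeterSystem.IsRightDescent, h]
    have hws : cs.IsLeftDescent (w * cs.simple j) i ↔ cs.IsRightDescent (w * cs.simple j) j := by
      rw [← h, CoxeterSystem.IsLeftDescent, CoxeterSystem.IsRightDescent,
        cs.simple_mul_simple_cancel_left, h, cs.simple_mul_simple_cancel_right]
    simp only [h, hcoeff, hw, hws]
  · simp only [isLeftDescent_mul_simple_iff cs h, isRightDescent_simple_mul_iff cs h, smul_add,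
      smul_smul]
    rw [mul_comm (if cs.IsRightDescent w j then _ else _)]
    abel

theorem leftOp_mul_self (i : B) :
    leftOp cs φ i * leftOp cs φ i = 1 + heckeCoeff φ i • leftOp cs φ i := by
  classical
  refine Finsupp.lhom_ext' fun w => LinearMap.ext_ring ?_
  simp only [LinearMap.comp_apply, Finsupp.lsingle_apply, Module.End.mul_apply, leftOp_single,
    map_add, map_smul, LinearMap.add_apply, LinearMap.smul_apply, Module.End.one_apply,
    cs.simple_mul_simple_cancel_left]
  have hdesc := cs.isLeftDescent_iff_not_isLeftDescent_mul (w := w) (i := i)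
  by_cases h : cs.IsLeftDescent w i
  · simp only [h, hdesc.1 h, if_true, if_false, zero_smul, add_zero, smul_add]
  · simp only [h, not_not.1 (mt hdesc.2 h), if_true, if_false, zero_smul, add_zero]

variable {cs} in
theorem end_ext_of_commute_rightOp {f g : Module.End (GroupRing Γ) (W →₀ GroupRing Γ)}
    (hf : ∀ j, Commute f (rightOp cs φ j)) (hg : ∀ j, Commute g (rightOp cs φ j))
    (h : f (Finsupp.single 1 1) = g (Finsupp.single 1 1)) : f = g := by
  classical
  refine Finsupp.lhom_ext' fun w => LinearMap.ext_ring ?_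
  change f (Finsupp.single w 1) = g (Finsupp.single w 1)
  induction w using ascent_induction_right cs with
  | one => exact h
  | mul_simple w j hj ih =>
    have hw : Finsupp.single (w * cs.simple j) 1 = rightOp cs φ j (Finsupp.single w 1) := by
      rw [rightOp_single, if_neg hj, zero_smul, add_zero]
    rw [hw, ← Module.End.mul_apply, ← Module.End.mul_apply, (hf j).eq, (hg j).eq,
      Module.End.mul_apply, Module.End.mul_apply, ih]

theorem exists_commute_rightOp_apply_single_one (hφ : IsParameter cs φ) (w : W) :
    ∃ f : Module.End (GroupRing Γ) (W →₀ GroupRing Γ),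
      (∀ j, Commute f (rightOp cs φ j)) ∧ f (Finsupp.single 1 1) = Finsupp.single w 1 := by
  classical
  induction w using ascent_induction_left cs with
  | one => exact ⟨1, fun j => Commute.one_left _, rfl⟩
  | simple_mul i w hi ih =>
    obtain ⟨f, hf, hfw⟩ := ih
    refine ⟨leftOp cs φ i * f, fun j => (commute_leftOp_rightOp cs hφ i j).mul_left (hf j), ?_⟩
    rw [Module.End.mul_apply, hfw, leftOp_single, if_neg hi, zero_smul, add_zero]

variable {cs}

/-- Left multiplication by `T_w` on the free module with basis `W`, characterised as the
endomorphism that commutes with the right multiplications and sends `1` to `w`. -/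
def leftMul (hφ : IsParameter cs φ) (w : W) : Module.End (GroupRing Γ) (W →₀ GroupRing Γ) :=
  (exists_commute_rightOp_apply_single_one cs hφ w).choose

theorem commute_leftMul_rightOp (hφ : IsParameter cs φ) (w : W) (j : B) :
    Commute (leftMul hφ w) (rightOp cs φ j) :=
  (exists_commute_rightOp_apply_single_one cs hφ w).choose_spec.1 j

theorem leftMul_single_one (hφ : IsParameter cs φ) (w : W) :
    leftMul hφ w (Finsupp.single 1 1) = Finsupp.single w 1 :=
  (exists_commute_rightOp_apply_single_one cs hφ w).choose_spec.2

theorem eq_leftMul (hφ : IsParameter cs φ) {w : W}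
    {f : Module.End (GroupRing Γ) (W →₀ GroupRing Γ)} (hf : ∀ j, Commute f (rightOp cs φ j))
    (h : f (Finsupp.single 1 1) = Finsupp.single w 1) : f = leftMul hφ w :=
  end_ext_of_commute_rightOp hf (commute_leftMul_rightOp hφ w)
    (h.trans (leftMul_single_one hφ w).symm)

theorem leftMul_simple (hφ : IsParameter cs φ) (i : B) :
    leftMul hφ (cs.simple i) = leftOp cs φ i := by
  classical
  refine (eq_leftMul hφ (commute_leftOp_rightOp cs hφ i) ?_).symm
  rw [leftOp_single, if_neg (cs.not_isLeftDescent_one i), zero_smul, add_zero, mul_one]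

theorem isHeckeFamily_leftMul (hφ : IsParameter cs φ) : IsHeckeFamily cs φ (leftMul hφ) where
  map_one := (eq_leftMul hφ (fun _ => Commute.one_left _) rfl).symm
  map_simple_mul i w hi := by
    classical
    refine eq_leftMul hφ (fun j => (commute_leftMul_rightOp hφ _ j).mul_left
      (commute_leftMul_rightOp hφ w j)) ?_
    rw [Module.End.mul_apply, leftMul_single_one, leftMul_simple, leftOp_single, if_neg hi,
      zero_smul, add_zero]
  map_simple_sq i := by rw [leftMul_simple, leftOp_mul_self]

theorem linearIndependent_T (hφ : IsParameter cs φ) :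
    LinearIndependent (GroupRing Γ) (T cs φ) := by
  let eval : Hecke cs φ →ₗ[GroupRing Γ] (W →₀ GroupRing Γ) :=
    (LinearMap.applyₗ (Finsupp.single (1 : W) (1 : GroupRing Γ))).comp
      (heckeLift (isHeckeFamily_leftMul hφ)).toLinearMap
  have heval : eval ∘ T cs φ = fun w => Finsupp.single w 1 := funext fun w => by
    simp [eval, leftMul_single_one]
  exact .of_comp eval (heval ▸ Finsupp.linearIndependent_single_one _ _)

/-- The basis `(T_w)` of the Hecke algebra. -/
def TBasis (hφ : IsParameter cs φ) : Module.Basis W (GroupRing Γ) (Hecke cs φ) :=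
  .mk (linearIndependent_T hφ) (span_range_T cs φ).ge

@[simp]
theorem TBasis_apply (hφ : IsParameter cs φ) (w : W) : TBasis hφ w = T cs φ w :=
  Module.Basis.mk_apply _ _ w

end RegularRepresentation

end HeckeAlgebra

section NegativeScalars

theorem groupRing_ext {Γ : Type*} {a b : GroupRing Γ} (h : ∀ γ, a.coeff γ = b.coeff γ) : a = b :=
  AddMonoidAlgebra.ext (Finsupp.ext h)

variable {Γ : Type*} [AddCommGroup Γ]

theorem coeff_barScalar (a : GroupRing Γ) (γ : Γ) : (barScalar Γ a).coeff γ = a.coeff (-γ) := by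
  conv_lhs => rw [← neg_neg γ]
  exact Finsupp.mapDomain_apply neg_injective _ _

theorem barScalar_barScalar (a : GroupRing Γ) : barScalar Γ (barScalar Γ a) = a :=
  groupRing_ext fun γ => by rw [coeff_barScalar, coeff_barScalar, neg_neg]

variable (Γ) in
/-- `ℤ[Γ_{<0}]`, as an additive subgroup of `ℤ[Γ]`. -/
def negScalars [LinearOrder Γ] : AddSubgroup (GroupRing Γ) where
  carrier := {a | ∀ γ, 0 ≤ γ → a.coeff γ = 0}
  zero_mem' _ _ := rfl
  add_mem' ha hb γ hγ := by
    rw [AddMonoidAlgebra.coeff_add, Finsupp.add_apply, ha γ hγ, hb γ hγ, add_zero]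
  neg_mem' ha γ hγ := by rw [AddMonoidAlgebra.coeff_neg, Finsupp.neg_apply, ha γ hγ, neg_zero]

variable [LinearOrder Γ]

theorem expo_mem_negScalars {γ : Γ} (hγ : γ < 0) : expo γ ∈ negScalars Γ := fun _ hδ =>
  Finsupp.single_eq_of_ne (hγ.trans_le hδ).ne'

theorem negScalars_le_closure_expo :
    negScalars Γ ≤ AddSubgroup.closure (expo '' Set.Iio (0 : Γ)) := by
  intro a ha
  have hsum : a = a.coeff.sum fun γ n => n • expo γ := by
    conv_lhs => rw [← AddMonoidAlgebra.sum_coeff_single a]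
    simp [expo, AddMonoidAlgebra.smul_single]
  rw [hsum]
  refine sum_mem fun γ hγ => zsmul_mem (AddSubgroup.subset_closure (Set.mem_image_of_mem _ ?_)) _
  exact lt_of_not_ge fun hc => Finsupp.mem_support_iff.1 hγ (ha γ hc)

/-- The component in `ℤ[Γ_{<0}]` of an element of `ℤ[Γ]`. -/
def negPart (a : GroupRing Γ) : GroupRing Γ := .ofCoeff (a.coeff.filter (· < 0))

theorem coeff_negPart (a : GroupRing Γ) (γ : Γ) :
    (negPart a).coeff γ = if γ < 0 then a.coeff γ else 0 :=
  Finsupp.filter_apply _ _ _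

theorem negPart_zero : negPart (0 : GroupRing Γ) = 0 :=
  groupRing_ext fun γ => by rw [coeff_negPart]; exact ite_self _

theorem negPart_mem_negScalars (a : GroupRing Γ) : negPart a ∈ negScalars Γ := fun γ h => by
  rw [coeff_negPart, if_neg h.not_gt]

variable [IsOrderedAddMonoid Γ]

theorem negPart_sub_barScalar_negPart {a : GroupRing Γ} (h : barScalar Γ a = -a) :
    negPart a - barScalar Γ (negPart a) = a := by
  refine groupRing_ext fun γ => ?_
  have hodd : a.coeff (-γ) = -a.coeff γ := by
    rw [← coeff_barScalar, h, AddMonoidAlgebra.coeff_neg, Finsupp.neg_apply]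
  rw [AddMonoidAlgebra.coeff_sub, Finsupp.sub_apply, coeff_barScalar, coeff_negPart, coeff_negPart,
    hodd]
  simp only [neg_lt_zero]
  rcases lt_trichotomy γ 0 with hγ | rfl | hγ
  · rw [if_pos hγ, if_neg hγ.not_gt, sub_zero]
  · rw [neg_zero] at hodd
    rw [if_neg (lt_irrefl _), if_neg (lt_irrefl _), sub_zero, self_eq_neg.1 hodd]
  · rw [if_neg hγ.not_gt, if_pos hγ, zero_sub, neg_neg]

theorem eq_zero_of_mem_negScalars_of_barScalar_eq {a : GroupRing Γ} (ha : a ∈ negScalars Γ)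
    (h : barScalar Γ a = a) : a = 0 := by
  refine groupRing_ext fun γ => ?_
  rcases le_total 0 γ with hγ | hγ
  · exact ha γ hγ
  · rw [← h, coeff_barScalar]
    exact ha _ (neg_nonneg.2 hγ)

end NegativeScalars

section Unitriangular

variable {ι R V : Type*} [CommRing R] [AddCommGroup V] [Module R V]
  (b : Module.Basis ι R V) (ℓ : ι → ℕ)

/-- The span of the basis vectors `b i` of degree `ℓ i < n`. -/
def lowSpan (n : ℕ) : Submodule R V := Submodule.span R (b '' {i | ℓ i < n})

variable {b ℓ}

theorem basis_mem_lowSpan {n : ℕ} {i : ι} (h : ℓ i < n) : b i ∈ lowSpan b ℓ n :=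
  Submodule.subset_span ⟨i, h, rfl⟩

theorem lowSpan_mono {m n : ℕ} (h : m ≤ n) : lowSpan b ℓ m ≤ lowSpan b ℓ n :=
  Submodule.span_mono (Set.image_mono fun _ hi => lt_of_lt_of_le hi h)

theorem lowSpan_zero : lowSpan b ℓ 0 = ⊥ := by simp [lowSpan]

theorem mem_lowSpan_iff {n : ℕ} {v : V} : v ∈ lowSpan b ℓ n ↔ ∀ i, n ≤ ℓ i → b.repr v i = 0 := by
  rw [lowSpan, Module.Basis.mem_span_image]
  refine ⟨fun h i hi => by_contra fun hne => (h (Finsupp.mem_support_iff.2 hne)).not_ge hi,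
    fun h i hi => lt_of_not_ge fun hle => Finsupp.mem_support_iff.1 hi (h i hle)⟩

theorem exists_mem_lowSpan (v : V) : ∃ n, v ∈ lowSpan b ℓ n :=
  ⟨(b.repr v).support.sup ℓ + 1, (b.mem_span_image).2 fun _ hi =>
    Nat.lt_succ_of_le (Finset.le_sup (f := ℓ) hi)⟩

variable {σ : R →+* R}

variable (b ℓ) in
/-- A semilinear endomorphism is unitriangular, with respect to the degree `ℓ` on the basis `b`, if
it fixes each `b i` up to basis vectors of degree less than `ℓ i`. -/
def IsUnitriangular (f : V →ₛₗ[σ] V) : Prop := ∀ i, f (b i) - b i ∈ lowSpan b ℓ (ℓ i)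

namespace IsUnitriangular

theorem repr_apply {f : V →ₛₗ[σ] V} (hf : IsUnitriangular b ℓ f) {n : ℕ} {v : V}
    (hv : v ∈ lowSpan b ℓ (n + 1)) {i : ι} (hi : n ≤ ℓ i) : b.repr (f v) i = σ (b.repr v i) := by
  classical
  induction hv using Submodule.span_induction with
  | mem x hx =>
    obtain ⟨j, hj, rfl⟩ := hx
    have h := mem_lowSpan_iff.1 (hf j) i ((Nat.lt_succ_iff.1 hj).trans hi)
    rw [map_sub, Finsupp.sub_apply, sub_eq_zero] at h
    rw [h, b.repr_self, Finsupp.single_apply, apply_ite σ, map_one, map_zero]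
  | zero => simp
  | add x y _ _ hx hy => simp only [map_add, Finsupp.add_apply, hx, hy]
  | smul a x _ hx =>
    simp only [map_smulₛₗ, RingHom.id_apply, Finsupp.smul_apply, smul_eq_mul, map_mul, hx]

theorem bijective {f : V →ₗ[R] V} (hf : IsUnitriangular b ℓ f) : Function.Bijective f := by
  refine ⟨(injective_iff_map_eq_zero f).2 fun v hv => ?_, fun v => ?_⟩ <;>
    obtain ⟨n, hn⟩ := exists_mem_lowSpan (b := b) (ℓ := ℓ) v
  · induction n with
    | zero => simpa [lowSpan_zero] using hn
    | succ n ih =>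
      refine ih (mem_lowSpan_iff.2 fun i hi => ?_)
      simpa [hv] using (hf.repr_apply hn hi).symm
  · induction n generalizing v with
    | zero => exact ⟨0, by simpa [lowSpan_zero, eq_comm] using hn⟩
    | succ n ih =>
      have hlow : v - f v ∈ lowSpan b ℓ n := mem_lowSpan_iff.2 fun i hi => by
        rw [map_sub, Finsupp.sub_apply, hf.repr_apply hn hi, RingHom.id_apply, sub_self]
      obtain ⟨u, hu⟩ := ih _ hlow
      exact ⟨u + v, by rw [map_add, hu, sub_add_cancel]⟩

variable {Γ : Type*} [AddCommGroup Γ] [LinearOrder Γ] [IsOrderedAddMonoid Γ]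
  {V : Type*} [AddCommGroup V] [Module (GroupRing Γ) V] {b : Module.Basis ι (GroupRing Γ) V}
  {β : V →ₛₗ[barScalar Γ] V}

theorem eq_zero_of_apply_eq (hβ : IsUnitriangular b ℓ β) {v : V} (hv : β v = v)
    (hneg : ∀ i, b.repr v i ∈ negScalars Γ) : v = 0 := by
  obtain ⟨n, hn⟩ := exists_mem_lowSpan (b := b) (ℓ := ℓ) v
  induction n with
  | zero => simpa [lowSpan_zero] using hn
  | succ n ih =>
    refine ih (mem_lowSpan_iff.2 fun i hi => ?_)
    refine eq_zero_of_mem_negScalars_of_barScalar_eq (hneg i) ?_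
    rw [← hβ.repr_apply hn hi, hv]

theorem exists_sub_apply_eq (hβ : IsUnitriangular b ℓ β) (hinv : Function.Involutive β)
    {n : ℕ} {v : V} (hn : v ∈ lowSpan b ℓ n) (hv : β v = -v) :
    ∃ u ∈ lowSpan b ℓ n, (∀ i, b.repr u i ∈ negScalars Γ) ∧ u - β u = v := by
  induction n generalizing v with
  | zero => exact ⟨0, zero_mem _, by simp [zero_mem], by simpa [lowSpan_zero, eq_comm] using hn⟩
  | succ n ih =>
    set u := b.repr.symm ((b.repr v).mapRange negPart negPart_zero) with hu
    have hrepr (i : ι) : b.repr u i = negPart (b.repr v i) := by simp [hu]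
    have hun : u ∈ lowSpan b ℓ (n + 1) := mem_lowSpan_iff.2 fun i hi => by
      rw [hrepr, mem_lowSpan_iff.1 hn i hi, negPart_zero]
    have hlow : v - (u - β u) ∈ lowSpan b ℓ n := mem_lowSpan_iff.2 fun i hi => by
      have hodd : barScalar Γ (b.repr v i) = -b.repr v i := by
        rw [← hβ.repr_apply hn hi, hv, map_neg, Finsupp.neg_apply]
      rw [map_sub, map_sub, Finsupp.sub_apply, Finsupp.sub_apply, hβ.repr_apply hun hi, hrepr,
        negPart_sub_barScalar_negPart hodd, sub_self]
    obtain ⟨u', hun', hneg', hu'⟩ := ih hlow (by rw [map_sub, map_sub, hinv, hv]; abel)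
    refine ⟨u + u', add_mem hun (lowSpan_mono n.le_succ hun'), fun i => ?_, ?_⟩
    · rw [map_add, Finsupp.add_apply, hrepr]
      exact add_mem (negPart_mem_negScalars _) (hneg' i)
    · rw [map_add, add_sub_add_comm, hu', add_sub_cancel]

theorem exists_apply_eq_self (hβ : IsUnitriangular b ℓ β) (hinv : Function.Involutive β) (i : ι) :
    ∃ c, β c = c ∧ (∀ j, b.repr (c - b i) j ∈ negScalars Γ) ∧ c - b i ∈ lowSpan b ℓ (ℓ i) := by
  obtain ⟨u, hu, hneg, hui⟩ := hβ.exists_sub_apply_eq hinv (hβ i) (by rw [map_sub, hinv, neg_sub])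
  refine ⟨b i + u, ?_, by rwa [add_sub_cancel_left], by rwa [add_sub_cancel_left]⟩
  rw [map_add, ← sub_eq_zero, ← sub_eq_zero.2 hui.symm]
  abel

end IsUnitriangular

end Unitriangular

section KazhdanLusztigBasis

variable {B W : Type*} [Group W] {M : CoxeterMatrix B} (cs : CoxeterSystem M W)
variable {Γ : Type*} [AddCommGroup Γ] (φ : B → Γ)

theorem bar_smul (a : GroupRing Γ) (h : Hecke cs φ) :
    bar cs φ (a • h) = barScalar Γ a • bar cs φ h := by
  rw [Algebra.smul_def, map_mul, bar_algebraMap, ← Algebra.smul_def]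

/-- The bar involution as a semilinear map. -/
def barSemilinear : Hecke cs φ →ₛₗ[barScalar Γ] Hecke cs φ :=
  { bar cs φ with map_smul' := bar_smul cs φ }

@[simp]
theorem barSemilinear_apply (h : Hecke cs φ) : barSemilinear cs φ h = bar cs φ h := rfl

theorem bar_T_mul_T_inv (w : W) : bar cs φ (T cs φ w) * T cs φ w⁻¹ = 1 := by
  rw [bar_T, ← coe_TUnit, Units.inv_mul]

theorem bar_T_simple (i : B) : bar cs φ (T cs φ (cs.simple i)) =
    T cs φ (cs.simple i) - heckeCoeff φ i • 1 := by
  have hleft := bar_T_mul_T_inv cs φ (cs.simple i)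
  rw [cs.inv_simple] at hleft
  refine left_inv_eq_right_inv hleft ?_
  rw [mul_sub, (isHeckeFamily_T cs φ).map_simple_sq, mul_smul_comm, mul_one, add_sub_cancel_right]

theorem bar_bar (h : Hecke cs φ) : bar cs φ (bar cs φ h) = h := by
  induction h using hecke_induction with
  | T w =>
    refine left_inv_eq_right_inv (a := bar cs φ (T cs φ w⁻¹)) ?_ ?_
    · rw [← map_mul, bar_T_mul_T_inv, map_one]
    · simpa only [inv_inv] using bar_T_mul_T_inv cs φ w⁻¹
  | add x y hx hy => rw [map_add, map_add, hx, hy]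
  | smul a x hx => rw [bar_smul, bar_smul, barScalar_barScalar, hx]

variable {cs φ}

theorem T_simple_mul_mem_lowSpan (hφ : IsParameter cs φ) (i : B) {n : ℕ} {h : Hecke cs φ}
    (hh : h ∈ lowSpan (TBasis hφ) cs.length n) :
    T cs φ (cs.simple i) * h ∈ lowSpan (TBasis hφ) cs.length (n + 1) := by
  classical
  have hcomap : lowSpan (TBasis hφ) cs.length n ≤ (lowSpan (TBasis hφ) cs.length (n + 1)).comap
      (LinearMap.mulLeft (GroupRing Γ) (T cs φ (cs.simple i))) := by
    refine Submodule.span_le.2 ?_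
    rintro _ ⟨w, hw : cs.length w < n, rfl⟩
    have hiw := cs.length_mul_le (cs.simple i) w
    rw [cs.length_simple] at hiw
    rw [SetLike.mem_coe, Submodule.mem_comap, LinearMap.mulLeft_apply, TBasis_apply, T_simple_mul,
      ← TBasis_apply hφ, ← TBasis_apply hφ]
    exact add_mem (basis_mem_lowSpan (by omega))
      (Submodule.smul_mem _ _ (basis_mem_lowSpan (by omega)))
  exact hcomap hh

theorem isUnitriangular_barSemilinear (hφ : IsParameter cs φ) :
    IsUnitriangular (TBasis hφ) cs.length (barSemilinear cs φ) := by
  intro w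
  rw [barSemilinear_apply, TBasis_apply]
  induction w using ascent_induction_left cs with
  | one => rw [T_one, map_one, sub_self]; exact zero_mem _
  | simple_mul i w hi ih =>
    have hbar : bar cs φ (T cs φ w) ∈ lowSpan (TBasis hφ) cs.length (cs.length w + 1) := by
      rw [← sub_add_cancel (bar cs φ (T cs φ w)) (T cs φ w)]
      refine add_mem (lowSpan_mono (Nat.le_succ _) ih) ?_
      exact TBasis_apply hφ w ▸ basis_mem_lowSpan (Nat.lt_succ_self _)
    have hexpand : bar cs φ (T cs φ (cs.simple i * w)) - T cs φ (cs.simple i * w) =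
        T cs φ (cs.simple i) * (bar cs φ (T cs φ w) - T cs φ w) -
          heckeCoeff φ i • bar cs φ (T cs φ w) := by
      rw [← (isHeckeFamily_T cs φ).map_simple_mul i w hi, map_mul, bar_T_simple, sub_mul, mul_sub,
        smul_mul_assoc, one_mul, sub_right_comm]
    rw [hexpand, cs.not_isLeftDescent_iff.1 hi]
    exact sub_mem (T_simple_mul_mem_lowSpan hφ i ih) (Submodule.smul_mem _ _ hbar)

variable [LinearOrder Γ]

theorem mem_heckeNeg_iff (hφ : IsParameter cs φ) {h : Hecke cs φ} :
    h ∈ heckeNeg cs φ ↔ ∀ w, (TBasis hφ).repr h w ∈ negScalars Γ := by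
  classical
  refine ⟨fun hh w => ?_, fun hh => ?_⟩
  · induction hh using AddSubgroup.closure_induction with
    | mem x hx =>
      obtain ⟨γ, hγ, v, rfl⟩ := hx
      rw [map_smul, ← TBasis_apply hφ, Module.Basis.repr_self, Finsupp.smul_single, smul_eq_mul,
        mul_one, Finsupp.single_apply]
      split_ifs
      · exact expo_mem_negScalars hγ
      · exact zero_mem _
    | zero => rw [map_zero]; exact zero_mem _
    | add x y _ _ hx hy => rw [map_add]; exact add_mem hx hy
    | neg x _ hx => rw [map_neg]; exact neg_mem hx
  · rw [← (TBasis hφ).linearCombination_repr h]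
    refine sum_mem fun w _ => ?_
    have hle : negScalars Γ ≤ (heckeNeg cs φ).comap
        ((AddMonoidHom.flip (smulAddHom (GroupRing Γ) (Hecke cs φ))) (T cs φ w)) := by
      refine negScalars_le_closure_expo.trans ((AddSubgroup.closure_le _).2 ?_)
      rintro _ ⟨γ, hγ, rfl⟩
      exact AddSubgroup.subset_closure ⟨γ, hγ, w, rfl⟩
    simpa using hle (hh w)

variable [IsOrderedAddMonoid Γ]

theorem IsKL.unique (hφ : IsParameter cs φ) {w : W} {c d : Hecke cs φ} (hc : IsKL cs φ w c)
    (hd : IsKL cs φ w d) : c = d := by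
  refine sub_eq_zero.1 ((isUnitriangular_barSemilinear hφ).eq_zero_of_apply_eq ?_
    ((mem_heckeNeg_iff hφ).1 ?_))
  · rw [barSemilinear_apply, map_sub, hc.1, hd.1]
  · rw [← sub_sub_sub_cancel_right c d (T cs φ w)]
    exact sub_mem hc.2 hd.2

theorem exists_isKL_sub_mem_lowSpan (hφ : IsParameter cs φ) (w : W) :
    ∃ c, IsKL cs φ w c ∧ c - T cs φ w ∈ lowSpan (TBasis hφ) cs.length (cs.length w) := by
  obtain ⟨c, hbar, hneg, hlow⟩ :=
    (isUnitriangular_barSemilinear hφ).exists_apply_eq_self (bar_bar cs φ) w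
  rw [TBasis_apply] at hlow
  exact ⟨c, ⟨hbar, (mem_heckeNeg_iff hφ).2 (by simpa using hneg)⟩, hlow⟩

theorem isKL_KL (hφ : IsParameter cs φ) (w : W) : IsKL cs φ w (KL cs φ w) := by
  have h : ∃ c, IsKL cs φ w c := (exists_isKL_sub_mem_lowSpan hφ w).imp fun _ => And.left
  rw [KL, dif_pos h]
  exact h.choose_spec

theorem IsKL.eq_KL (hφ : IsParameter cs φ) {w : W} {c : Hecke cs φ} (h : IsKL cs φ w c) :
    c = KL cs φ w :=
  h.unique hφ (isKL_KL hφ w)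

theorem isUnitriangular_constr_KL (hφ : IsParameter cs φ) :
    IsUnitriangular (TBasis hφ) cs.length ((TBasis hφ).constr (GroupRing Γ) (KL cs φ)) := by
  intro w
  obtain ⟨c, hc, hlow⟩ := exists_isKL_sub_mem_lowSpan hφ w
  rwa [Module.Basis.constr_basis, TBasis_apply, ← hc.eq_KL hφ]

/-- The Kazhdan–Lusztig basis `(C_w)`. -/
def KLBasis (hφ : IsParameter cs φ) : Module.Basis W (GroupRing Γ) (Hecke cs φ) :=
  (TBasis hφ).map (.ofBijective _ (isUnitriangular_constr_KL hφ).bijective)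

@[simp]
theorem KLBasis_apply (hφ : IsParameter cs φ) (w : W) : KLBasis hφ w = KL cs φ w := by
  rw [KLBasis, Module.Basis.map_apply, LinearEquiv.ofBijective_apply, Module.Basis.constr_basis]

end KazhdanLusztigBasis

section ReflectionSubgroup

variable {B W : Type*} [Group W] {M : CoxeterMatrix B} (cs : CoxeterSystem M W) (I : Set B)

theorem simple_mem_parabolic {i : B} (hi : i ∈ I) : cs.simple i ∈ parabolic cs I :=
  Subgroup.subset_closure ⟨i, hi, rfl⟩

theorem simple_mem_tildeJ {j : B} (hj : j ∉ I) : cs.simple j ∈ tildeJ cs I :=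
  ⟨j, hj, 1, one_mem _, by rw [one_mul, inv_one, mul_one]⟩

theorem conj_mem_tildeJ {a t : W} (ha : a ∈ parabolic cs I) (ht : t ∈ tildeJ cs I) :
    a * t * a⁻¹ ∈ tildeJ cs I := by
  obtain ⟨j, hj, w, hw, rfl⟩ := ht
  exact ⟨j, hj, a * w, mul_mem ha hw, by group⟩

theorem tildeJ_mul_self {t : W} (ht : t ∈ tildeJ cs I) : t * t = 1 := by
  obtain ⟨j, -, w, -, rfl⟩ := ht
  simp [mul_assoc]

theorem tildeJ_inv {t : W} (ht : t ∈ tildeJ cs I) : t⁻¹ = t :=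
  inv_eq_of_mul_eq_one_right (tildeJ_mul_self cs I ht)

theorem tildeJ_subset_tildeW : tildeJ cs I ⊆ tildeW cs I := Subgroup.subset_closure

instance : MulAction (parabolic cs I) (tildeJ cs I) where
  smul a t := ⟨a * t * (a : W)⁻¹, conj_mem_tildeJ cs I a.2 t.2⟩
  one_smul t := Subtype.ext (show (1 : W) * t * 1⁻¹ = t by group)
  mul_smul a b t := Subtype.ext
    (show (a * b : W) * t * (a * b : W)⁻¹ = a * (b * t * (b : W)⁻¹) * (a : W)⁻¹ by group)

theorem coe_parabolic_smul (a : parabolic cs I) (t : tildeJ cs I) :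
    ((a • t : tildeJ cs I) : W) = a * t * (a : W)⁻¹ := rfl

/-- The Coxeter matrix of `J̃`, given by the orders in `W` of the products of two elements. -/
def tildeMatrix : CoxeterMatrix (tildeJ cs I) where
  M t t' := orderOf ((t : W) * t')
  isSymm := by
    ext t t'
    change orderOf ((t' : W) * t) = orderOf ((t : W) * t')
    rw [← orderOf_inv, mul_inv_rev, tildeJ_inv cs I t.2, tildeJ_inv cs I t'.2]
  diagonal t := by rw [tildeJ_mul_self cs I t.2, orderOf_one]
  off_diagonal t t' h := by
    rw [Ne, orderOf_eq_one_iff, mul_eq_one_iff_eq_inv, tildeJ_inv cs I t'.2]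
    exact fun h' => h (Subtype.ext h')

/-- The abstract Coxeter system with Coxeter matrix `tildeMatrix cs I`; it is identified with
`(W̃, J̃)` in `tildeSystem`. -/
abbrev tildeAbs : CoxeterSystem (tildeMatrix cs I) (tildeMatrix cs I).Group :=
  (tildeMatrix cs I).toCoxeterSystem

theorem tildeAbs_pow_eq_one (t t' : tildeJ cs I) {n : ℕ} (h : ((t : W) * t') ^ n = 1) :
    ((tildeAbs cs I).simple t * (tildeAbs cs I).simple t') ^ n = 1 := by
  obtain ⟨k, rfl⟩ : tildeMatrix cs I t t' ∣ n := orderOf_dvd_of_pow_eq_one h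
  rw [pow_mul, CoxeterSystem.simple_mul_simple_pow, one_pow]

theorem isLiftable_tildeAbs_smul (a : parabolic cs I) :
    (tildeMatrix cs I).IsLiftable fun t => (tildeAbs cs I).simple (a • t) := by
  intro t t'
  apply tildeAbs_pow_eq_one
  have hconj : ((a • t : tildeJ cs I) : W) * (a • t' : tildeJ cs I) =
      a * (t * t' : W) * (a : W)⁻¹ := by
    rw [coe_parabolic_smul, coe_parabolic_smul]
    group
  rw [hconj, conj_pow, conj_eq_one_iff]
  exact pow_orderOf_eq_one _

/-- The endomorphism of the abstract Coxeter group that extends the conjugation of `J̃` by an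
element of `W_I`. -/
def tildeAbsConj (a : parabolic cs I) : (tildeMatrix cs I).Group →* (tildeMatrix cs I).Group :=
  (tildeAbs cs I).lift ⟨_, isLiftable_tildeAbs_smul cs I a⟩

theorem tildeAbsConj_simple (a : parabolic cs I) (t : tildeJ cs I) :
    tildeAbsConj cs I a ((tildeAbs cs I).simple t) = (tildeAbs cs I).simple (a • t) :=
  (tildeAbs cs I).lift_apply_simple (isLiftable_tildeAbs_smul cs I a) t

theorem tildeAbsConj_one : tildeAbsConj cs I 1 = MonoidHom.id _ :=
  (tildeAbs cs I).ext_simple fun t => by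
    rw [tildeAbsConj_simple, one_smul, MonoidHom.id_apply]

theorem tildeAbsConj_mul (a b : parabolic cs I) :
    tildeAbsConj cs I (a * b) = (tildeAbsConj cs I a).comp (tildeAbsConj cs I b) :=
  (tildeAbs cs I).ext_simple fun t => by
    simp only [MonoidHom.comp_apply, tildeAbsConj_simple, mul_smul]

/-- The action of `W_I` on the abstract Coxeter group that extends the conjugation action on
`J̃`. -/
def tildeAbsAut : parabolic cs I →* MulAut (tildeMatrix cs I).Group where
  toFun a := MonoidHom.toMulEquiv (tildeAbsConj cs I a) (tildeAbsConj cs I a⁻¹)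
    (by rw [← tildeAbsConj_mul, inv_mul_cancel, tildeAbsConj_one])
    (by rw [← tildeAbsConj_mul, mul_inv_cancel, tildeAbsConj_one])
  map_one' := MulEquiv.ext fun x => DFunLike.congr_fun (tildeAbsConj_one cs I) x
  map_mul' a b := MulEquiv.ext fun x => DFunLike.congr_fun (tildeAbsConj_mul cs I a b) x

theorem tildeAbsAut_simple (a : parabolic cs I) (t : tildeJ cs I) :
    tildeAbsAut cs I a ((tildeAbs cs I).simple t) = (tildeAbs cs I).simple (a • t) :=
  tildeAbsConj_simple cs I a t

/-- The semidirect product of the abstract Coxeter group by `W_I`. -/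
abbrev TildeSemidirect : Type _ := (tildeMatrix cs I).Group ⋊[tildeAbsAut cs I] parabolic cs I

open Classical in
/-- The image in the semidirect product of a simple reflection of `W`. -/
def semidirectSimple (i : B) : TildeSemidirect cs I :=
  if h : i ∈ I then .inr ⟨cs.simple i, simple_mem_parabolic cs I h⟩
  else .inl ((tildeAbs cs I).simple ⟨cs.simple i, simple_mem_tildeJ cs I h⟩)

variable {I}

theorem semidirectSimple_of_mem {i : B} (h : i ∈ I) :
    semidirectSimple cs I i = .inr ⟨cs.simple i, simple_mem_parabolic cs I h⟩ := dif_pos h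

theorem semidirectSimple_of_notMem {j : B} (h : j ∉ I) : semidirectSimple cs I j =
    .inl ((tildeAbs cs I).simple ⟨cs.simple j, simple_mem_tildeJ cs I h⟩) :=
  dif_neg h

theorem semidirectSimple_mul_self (i : B) :
    semidirectSimple cs I i * semidirectSimple cs I i = 1 := by
  by_cases h : i ∈ I
  · rw [semidirectSimple_of_mem cs h, ← map_mul, ← map_one SemidirectProduct.inr]
    exact congrArg _ (Subtype.ext (cs.simple_mul_simple_self i))
  · rw [semidirectSimple_of_notMem cs h, ← map_mul, CoxeterSystem.simple_mul_simple_self, map_one]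

theorem even_of_not_isConj {i j : B} (h : ¬ IsConj (cs.simple i) (cs.simple j)) :
    Even (M i j) := by
  by_contra hodd
  obtain ⟨k, hk⟩ := Nat.not_even_iff_odd.1 hodd
  set r := cs.simple i * cs.simple j with hr
  have hsemi : SemiconjBy (cs.simple i) (r⁻¹ ^ k) (r ^ k) :=
    SemiconjBy.pow_right (by simp [SemiconjBy, hr, mul_assoc]) k
  have hpow : r ^ k * r ^ k = r⁻¹ := by
    rw [eq_inv_iff_mul_eq_one, ← pow_add, ← pow_succ, ← two_mul, ← hk, hr, cs.simple_mul_simple_pow]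
  refine h (isConj_iff.2 ⟨r ^ k, ?_⟩)
  rw [← inv_pow, mul_assoc, hsemi.eq, ← mul_assoc, hpow, hr, mul_inv_rev, cs.inv_simple,
    cs.inv_simple, cs.simple_mul_simple_cancel_right]

theorem semidirectSimple_mul_pow_of_mem_of_notMem {i j : B} (hi : i ∈ I) (hj : j ∉ I)
    (h : ¬ IsConj (cs.simple i) (cs.simple j)) :
    (semidirectSimple cs I i * semidirectSimple cs I j) ^ M i j = 1 := by
  obtain ⟨k, hk⟩ := even_of_not_isConj cs h
  set a : parabolic cs I := ⟨cs.simple i, simple_mem_parabolic cs I hi⟩ with ha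
  set t : tildeJ cs I := ⟨cs.simple j, simple_mem_tildeJ cs I hj⟩ with ht
  have hinv : a⁻¹ = a := Subtype.ext (cs.inv_simple i)
  have hsq : (semidirectSimple cs I i * semidirectSimple cs I j) ^ 2 =
      .inl ((tildeAbs cs I).simple (a • t) * (tildeAbs cs I).simple t) := by
    rw [semidirectSimple_of_mem cs hi, semidirectSimple_of_notMem cs hj, map_mul,
      ← tildeAbsAut_simple, SemidirectProduct.inl_aut, hinv, sq]
    simp only [ha, ht, mul_assoc]
  have hpow : (((a • t : tildeJ cs I) : W) * t) ^ k = 1 := by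
    have hW : ((a • t : tildeJ cs I) : W) * t = (cs.simple i * cs.simple j) ^ 2 := by
      rw [coe_parabolic_smul, ← Subgroup.coe_inv, hinv, sq]
      simp only [ha, ht, mul_assoc]
    rw [hW, ← pow_mul, two_mul, ← hk, cs.simple_mul_simple_pow]
  rw [hk, ← two_mul, pow_mul, hsq, ← map_pow, tildeAbs_pow_eq_one cs I _ _ hpow, map_one]

theorem isLiftable_coe_tildeJ : (tildeMatrix cs I).IsLiftable fun t =>
    (⟨t, tildeJ_subset_tildeW cs I t.2⟩ : tildeW cs I) := fun t t' =>
  Subtype.ext (pow_orderOf_eq_one ((t : W) * t'))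

variable (I) in
/-- The morphism from the abstract Coxeter group to `W̃` that is the identity on `J̃`. -/
def fromTildeAbs : (tildeMatrix cs I).Group →* tildeW cs I :=
  (tildeAbs cs I).lift ⟨_, isLiftable_coe_tildeJ cs⟩

theorem fromTildeAbs_simple (t : tildeJ cs I) :
    fromTildeAbs cs I ((tildeAbs cs I).simple t) = ⟨t, tildeJ_subset_tildeW cs I t.2⟩ :=
  (tildeAbs cs I).lift_apply_simple (isLiftable_coe_tildeJ cs) t

theorem isLiftable_semidirectSimple
    (hI : ∀ i ∈ I, ∀ j ∉ I, ¬ IsConj (cs.simple i) (cs.simple j)) :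
    M.IsLiftable (semidirectSimple cs I) := by
  intro i j
  by_cases hi : i ∈ I <;> by_cases hj : j ∈ I
  · rw [semidirectSimple_of_mem cs hi, semidirectSimple_of_mem cs hj, ← map_mul, ← map_pow,
      ← map_one SemidirectProduct.inr]
    exact congrArg _ (Subtype.ext (cs.simple_mul_simple_pow i j))
  · exact semidirectSimple_mul_pow_of_mem_of_notMem cs hi hj (hI i hi j hj)
  · have h := semidirectSimple_mul_pow_of_mem_of_notMem cs hj hi (hI j hj i hi)
    rwa [M.symmetric, ← inv_eq_one, ← inv_pow, mul_inv_rev,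
      inv_eq_of_mul_eq_one_right (semidirectSimple_mul_self cs i),
      inv_eq_of_mul_eq_one_right (semidirectSimple_mul_self cs j)] at h
  · rw [semidirectSimple_of_notMem cs hi, semidirectSimple_of_notMem cs hj, ← map_mul, ← map_pow,
      tildeAbs_pow_eq_one cs I _ _ (cs.simple_mul_simple_pow i j), map_one]

variable (hI : ∀ i ∈ I, ∀ j ∉ I, ¬ IsConj (cs.simple i) (cs.simple j))

/-- The morphism from `W` to the semidirect product given by `semidirectSimple`. It is an
isomorphism, of which only the injectivity of its restriction to `W̃` is recorded. -/
def toSemidirect : W →* TildeSemidirect cs I :=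
  cs.lift ⟨semidirectSimple cs I, isLiftable_semidirectSimple cs hI⟩

theorem toSemidirect_simple (i : B) :
    toSemidirect cs hI (cs.simple i) = semidirectSimple cs I i :=
  cs.lift_apply_simple _ _

theorem toSemidirect_parabolic (a : parabolic cs I) : toSemidirect cs hI a = .inr a := by
  have h : (toSemidirect cs hI).comp (parabolic cs I).subtype = SemidirectProduct.inr := by
    refine MonoidHom.eq_of_eqOn_dense Subgroup.closure_closure_coe_preimage ?_
    rintro ⟨-, _⟩ ⟨i, hi, rfl⟩
    exact (toSemidirect_simple cs hI i).trans (semidirectSimple_of_mem cs hi)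
  exact DFunLike.congr_fun h a

theorem toSemidirect_tildeJ (t : tildeJ cs I) :
    toSemidirect cs hI t = .inl ((tildeAbs cs I).simple t) := by
  obtain ⟨j, hj, w, hw, ht⟩ := t.2
  obtain rfl : t = (⟨w, hw⟩ : parabolic cs I) • ⟨cs.simple j, simple_mem_tildeJ cs I hj⟩ :=
    Subtype.ext ht
  rw [coe_parabolic_smul, map_mul, map_mul, map_inv, toSemidirect_simple, toSemidirect_parabolic,
    semidirectSimple_of_notMem cs hj, ← tildeAbsAut_simple, SemidirectProduct.inl_aut, map_inv]

theorem toSemidirect_fromTildeAbs (x : (tildeMatrix cs I).Group) :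
    toSemidirect cs hI (fromTildeAbs cs I x) = .inl x := by
  have h : ((toSemidirect cs hI).comp (tildeW cs I).subtype).comp (fromTildeAbs cs I) =
      SemidirectProduct.inl := (tildeAbs cs I).ext_simple fun t => by
    rw [MonoidHom.comp_apply, fromTildeAbs_simple]
    exact toSemidirect_tildeJ cs hI t
  exact DFunLike.congr_fun h x

theorem fromTildeAbs_bijective
    (hI : ∀ i ∈ I, ∀ j ∉ I, ¬ IsConj (cs.simple i) (cs.simple j)) :
    Function.Bijective (fromTildeAbs cs I) := by
  refine ⟨fun x y h => SemidirectProduct.inl_injective (φ := tildeAbsAut cs I) ?_, ?_⟩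
  · rw [← toSemidirect_fromTildeAbs cs hI, h, toSemidirect_fromTildeAbs cs hI]
  · have hgen : Subgroup.closure (((↑) : tildeW cs I → W) ⁻¹' tildeJ cs I) = ⊤ :=
      Subgroup.closure_closure_coe_preimage
    rw [← MonoidHom.range_eq_top, eq_top_iff, ← hgen, Subgroup.closure_le]
    exact fun t ht => ⟨_, fromTildeAbs_simple cs ⟨t, ht⟩⟩

/-- The Coxeter system `(W̃, J̃)`. -/
def tildeSystem : CoxeterSystem (tildeMatrix cs I) (tildeW cs I) :=
  (tildeAbs cs I).map (MulEquiv.ofBijective _ (fromTildeAbs_bijective cs hI))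

theorem coe_tildeSystem_simple (t : tildeJ cs I) : ((tildeSystem cs hI).simple t : W) = t :=
  congrArg Subtype.val (fromTildeAbs_simple cs t)

theorem toSemidirect_tildeW (x : tildeW cs I) : ∃ y, toSemidirect cs hI x = .inl y := by
  obtain ⟨y, rfl⟩ := (fromTildeAbs_bijective cs hI).2 x
  exact ⟨y, toSemidirect_fromTildeAbs cs hI y⟩

theorem disjoint_parabolic_tildeW
    (hI : ∀ i ∈ I, ∀ j ∉ I, ¬ IsConj (cs.simple i) (cs.simple j)) :
    Disjoint (parabolic cs I) (tildeW cs I) := by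
  refine Subgroup.disjoint_def.2 fun {a} ha hx => ?_
  obtain ⟨y, hy⟩ := toSemidirect_tildeW cs hI ⟨a, hx⟩
  have h := (toSemidirect_parabolic cs hI ⟨a, ha⟩).symm.trans hy
  have h' := congrArg SemidirectProduct.rightHom h
  rw [SemidirectProduct.rightHom_inr, SemidirectProduct.rightHom_inl] at h'
  exact congrArg Subtype.val h'

variable (I) in
theorem parabolic_sup_tildeW : parabolic cs I ⊔ tildeW cs I = ⊤ := by
  rw [eq_top_iff, ← cs.subgroup_closure_range_simple, Subgroup.closure_le]
  rintro - ⟨i, rfl⟩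
  by_cases hi : i ∈ I
  · exact Subgroup.mem_sup_left (simple_mem_parabolic cs I hi)
  · exact Subgroup.mem_sup_right (tildeJ_subset_tildeW cs I (simple_mem_tildeJ cs I hi))

variable (I) in
theorem parabolic_le_normalizer_tildeW :
    parabolic cs I ≤ Subgroup.normalizer (tildeW cs I : Set W) :=
  Subgroup.le_normalizer_closure_iff.2 fun _ ha _ ht =>
    Subgroup.subset_closure (conj_mem_tildeJ cs I ha ht)

theorem isComplement'_parabolic_tildeW
    (hI : ∀ i ∈ I, ∀ j ∉ I, ¬ IsConj (cs.simple i) (cs.simple j)) :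
    (parabolic cs I).IsComplement' (tildeW cs I) := by
  refine Subgroup.isComplement'_of_disjoint_and_mul_eq_univ (disjoint_parabolic_tildeW cs hI) ?_
  rw [← Subgroup.coe_mul_of_left_le_normalizer_right _ _ (parabolic_le_normalizer_tildeW cs I),
    parabolic_sup_tildeW, Subgroup.coe_top]

/-- The component in `W̃` of an element of `W = W_I W̃`. -/
def tildePart (w : W) : tildeW cs I := ((isComplement'_parabolic_tildeW cs hI).equiv w).2

theorem tildePart_mul (a : parabolic cs I) (x : tildeW cs I) : tildePart cs hI (a * x) = x :=
  congrArg Prod.snd ((isComplement'_parabolic_tildeW cs hI).equiv.apply_symm_apply (a, x))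

theorem exists_eq_mul_tildePart (w : W) : ∃ a : parabolic cs I, w = a * tildePart cs hI w :=
  ⟨_, ((isComplement'_parabolic_tildeW cs hI).equiv_fst_mul_equiv_snd w).symm⟩

theorem tildePart_coe (x : tildeW cs I) : tildePart cs hI x = x := by
  simpa only [Subgroup.coe_one, one_mul] using tildePart_mul cs hI 1 x

theorem tildePart_parabolic_mul (a : parabolic cs I) (w : W) :
    tildePart cs hI (a * w) = tildePart cs hI w := by
  obtain ⟨b, hb⟩ := exists_eq_mul_tildePart cs hI w
  conv_lhs => rw [hb, ← mul_assoc]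
  exact tildePart_mul cs hI (a * b) _

theorem parabolic_mul_injective
    (hI : ∀ i ∈ I, ∀ j ∉ I, ¬ IsConj (cs.simple i) (cs.simple j)) :
    Function.Injective fun z : parabolic cs I × tildeW cs I => (z.1 * z.2 : W) :=
  (isComplement'_parabolic_tildeW cs hI).1

theorem isParameter_tildePhi {Γ : Type*} {φ : B → Γ} (hφ : IsParameter cs φ)
    {Mt : CoxeterMatrix (tildeJ cs I)} (cst : CoxeterSystem Mt (tildeW cs I))
    (hst : ∀ t, (cst.simple t : W) = t) : IsParameter cst (tildePhi cs I φ) := by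
  intro t t' h
  obtain ⟨x, hx⟩ := isConj_iff.1 h
  obtain ⟨j, -, a, -, ht⟩ := t.2
  have ht' : (t' : W) = x * a * cs.simple j * (x * a : W)⁻¹ := by
    rw [← hst t', ← hx, Subgroup.coe_mul, Subgroup.coe_mul, Subgroup.coe_inv, hst, ht]
    group
  rw [tildePhi_eq cs I φ hφ t j a ht, tildePhi_eq cs I φ hφ t' j (x * a) ht']

end ReflectionSubgroup

section TildeLength

variable {B W : Type*} [Group W] {M : CoxeterMatrix B} (cs : CoxeterSystem M W) {I : Set B}

theorem parabolic_induction {p : ∀ a, a ∈ parabolic cs I → Prop} (one : p 1 (one_mem _))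
    (simple_mul : ∀ i (hi : i ∈ I) a (ha : a ∈ parabolic cs I), p a ha →
      p (cs.simple i * a) (mul_mem (simple_mem_parabolic cs I hi) ha))
    {a : W} (ha : a ∈ parabolic cs I) : p a ha := by
  induction ha using Subgroup.closure_induction_left with
  | one => exact one
  | mul_left _ hx a ha ih =>
    obtain ⟨i, hi, rfl⟩ := hx
    exact simple_mul i hi a ha ih
  | inv_mul_cancel _ hx a ha ih =>
    obtain ⟨i, hi, rfl⟩ := hx
    simpa only [cs.inv_simple] using simple_mul i hi a ha ih

variable (I) in
open Classical in
/-- The number of letters of a word that are not in `I`. -/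
def countOutside (ω : List B) : ℕ := ω.countP (· ∉ I)

theorem countOutside_append (ω ω' : List B) :
    countOutside I (ω ++ ω') = countOutside I ω + countOutside I ω' :=
  List.countP_append

theorem countOutside_cons_of_mem {i : B} (hi : i ∈ I) (ω : List B) :
    countOutside I (i :: ω) = countOutside I ω := by
  simp [countOutside, hi]

theorem countOutside_cons_of_notMem {i : B} (hi : i ∉ I) (ω : List B) :
    countOutside I (i :: ω) = countOutside I ω + 1 := by
  simp [countOutside, hi]

theorem exists_word_of_mem_parabolic {a : W} (ha : a ∈ parabolic cs I) :
    ∃ ω : List B, countOutside I ω = 0 ∧ cs.wordProd ω = a := by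
  induction ha using parabolic_induction cs with
  | one => exact ⟨[], rfl, cs.wordProd_nil⟩
  | simple_mul i hi a _ ih =>
    obtain ⟨ω, hω, rfl⟩ := ih
    exact ⟨i :: ω, (countOutside_cons_of_mem hi ω).trans hω, cs.wordProd_cons i ω⟩

variable (hI : ∀ i ∈ I, ∀ j ∉ I, ¬ IsConj (cs.simple i) (cs.simple j))
variable {Mt : CoxeterMatrix (tildeJ cs I)} (cst : CoxeterSystem Mt (tildeW cs I))

theorem length_tildePart_wordProd_le (hst : ∀ t, (cst.simple t : W) = t) (ω : List B) :
    cst.length (tildePart cs hI (cs.wordProd ω)) ≤ countOutside I ω := by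
  induction ω with
  | nil =>
    have h : tildePart cs hI 1 = 1 := tildePart_coe cs hI 1
    rw [cs.wordProd_nil, h, cst.length_one]
    exact Nat.zero_le _
  | cons i ω ih =>
    rw [cs.wordProd_cons]
    by_cases hi : i ∈ I
    · rw [countOutside_cons_of_mem hi]
      exact (congrArg cst.length (tildePart_parabolic_mul cs hI
        ⟨_, simple_mem_parabolic cs I hi⟩ _)).trans_le ih
    · obtain ⟨a, ha⟩ := exists_eq_mul_tildePart cs hI (cs.wordProd ω)
      set x := tildePart cs hI (cs.wordProd ω)
      set t : tildeJ cs I := a⁻¹ • ⟨_, simple_mem_tildeJ cs I hi⟩ with ht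
      have hmul : cs.simple i * cs.wordProd ω = a * (cst.simple t * x : tildeW cs I) := by
        rw [ha, Subgroup.coe_mul, hst, ht, coe_parabolic_smul, Subgroup.coe_inv]
        group
      rw [hmul, tildePart_mul, countOutside_cons_of_notMem hi]
      calc cst.length (cst.simple t * x) ≤ cst.length (cst.simple t) + cst.length x :=
            cst.length_mul_le _ _
        _ ≤ countOutside I ω + 1 := by rw [cst.length_simple, add_comm]; gcongr

theorem exists_word_countOutside_eq_length (hst : ∀ t, (cst.simple t : W) = t)
    (a : parabolic cs I) (x : tildeW cs I) :
    ∃ ω : List B, countOutside I ω = cst.length x ∧ cs.wordProd ω = a * x := by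
  induction x using ascent_induction_left cst generalizing a with
  | one =>
    obtain ⟨ω, hω, ha⟩ := exists_word_of_mem_parabolic cs a.2
    exact ⟨ω, by rw [hω, cst.length_one], by rw [ha, Subgroup.coe_one, mul_one]⟩
  | simple_mul t x hx ih =>
    obtain ⟨j, hj, w, hw, ht⟩ := t.2
    obtain ⟨ω₁, hω₁, hprod₁⟩ := exists_word_of_mem_parabolic cs (mul_mem a.2 hw)
    obtain ⟨ω₂, hω₂, hprod₂⟩ := ih ⟨w⁻¹, inv_mem hw⟩
    refine ⟨ω₁ ++ j :: ω₂, ?_, ?_⟩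
    · rw [countOutside_append, hω₁, countOutside_cons_of_notMem hj, hω₂, zero_add,
        cst.not_isLeftDescent_iff.1 hx]
    · rw [cs.wordProd_append, cs.wordProd_cons, hprod₁, hprod₂, Subgroup.coe_mul, hst, ht]
      group

theorem isLeftDescent_tilde (hI : ∀ i ∈ I, ∀ j ∉ I, ¬ IsConj (cs.simple i) (cs.simple j))
    (hst : ∀ t, (cst.simple t : W) = t) {t : tildeJ cs I} {j : B} (hj : j ∉ I)
    {a : parabolic cs I} (ht : (t : W) = a * cs.simple j * (a : W)⁻¹) {x : tildeW cs I}
    (h : cs.IsLeftDescent ((a : W)⁻¹ * x) j) : cst.IsLeftDescent x t := by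
  obtain ⟨ω, hω, hprod⟩ := exists_word_countOutside_eq_length cs cst hst a⁻¹ x
  rw [Subgroup.coe_inv] at hprod
  rw [← hprod] at h
  obtain ⟨ω₁, k, ω₂, rfl, hk, hexch⟩ := exists_exchange cs h
  have hkI : k ∉ I := fun hkI => hI k hkI j hj (isConj_iff.2 ⟨_, hk.symm⟩)
  have hmul : ((cst.simple t * x : tildeW cs I) : W) = a * cs.wordProd (ω₁ ++ ω₂) := by
    rw [← hexch, hprod, Subgroup.coe_mul, hst, ht]
    group
  calc cst.length (cst.simple t * x) = cst.length (tildePart cs hI (cs.wordProd (ω₁ ++ ω₂))) := by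
        rw [← tildePart_parabolic_mul cs hI a, ← hmul, tildePart_coe]
    _ ≤ countOutside I (ω₁ ++ ω₂) := length_tildePart_wordProd_le cs hI cst hst _
    _ < countOutside I (ω₁ ++ k :: ω₂) := by
        rw [countOutside_append, countOutside_append, countOutside_cons_of_notMem hkI]
        omega
    _ = cst.length x := hω

end TildeLength

section TildeHecke

variable {B W : Type*} [Group W] {M : CoxeterMatrix B} (cs : CoxeterSystem M W) {I : Set B}
variable {Γ : Type*} [AddCommGroup Γ] {φ : B → Γ}

theorem T_simple_mul_of_eq_zero {i : B} (h : φ i = 0) (w : W) :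
    T cs φ (cs.simple i) * T cs φ w = T cs φ (cs.simple i * w) := by
  rw [T_simple_mul, heckeCoeff, h, neg_zero, sub_self, ite_self, zero_smul, add_zero]

theorem T_mul_simple_of_eq_zero {i : B} (h : φ i = 0) (w : W) :
    T cs φ w * T cs φ (cs.simple i) = T cs φ (w * cs.simple i) := by
  by_cases hd : cs.IsRightDescent w i
  · have hw : T cs φ (w * cs.simple i) * T cs φ (cs.simple i) = T cs φ w := by
      rw [T_mul, cs.simple_mul_simple_cancel_right]
      rw [cs.simple_mul_simple_cancel_right, cs.length_simple, cs.isRightDescent_iff.1 hd]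
    rw [← hw, mul_assoc, T_simple_mul_of_eq_zero cs h, cs.simple_mul_simple_self, T_one, mul_one]
  · rw [T_mul]
    rw [cs.not_isRightDescent_iff.1 hd, cs.length_simple]

theorem T_parabolic_mul (hφI : ∀ i ∈ I, φ i = 0) {a : W} (ha : a ∈ parabolic cs I) (w : W) :
    T cs φ a * T cs φ w = T cs φ (a * w) := by
  induction ha using parabolic_induction cs with
  | one => rw [T_one, one_mul, one_mul]
  | simple_mul i hi a _ ih =>
    rw [← T_simple_mul_of_eq_zero cs (hφI i hi), mul_assoc, ih,
      T_simple_mul_of_eq_zero cs (hφI i hi), mul_assoc]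

theorem T_mul_parabolic (hφI : ∀ i ∈ I, φ i = 0) (w : W) {a : W} (ha : a ∈ parabolic cs I) :
    T cs φ w * T cs φ a = T cs φ (w * a) := by
  induction ha using parabolic_induction cs generalizing w with
  | one => rw [T_one, mul_one, mul_one]
  | simple_mul i hi a _ ih =>
    rw [← T_simple_mul_of_eq_zero cs (hφI i hi), ← mul_assoc,
      T_mul_simple_of_eq_zero cs (hφI i hi), ih, mul_assoc]

theorem bar_T_parabolic (hφI : ∀ i ∈ I, φ i = 0) {a : W} (ha : a ∈ parabolic cs I) :
    bar cs φ (T cs φ a) = T cs φ a := by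
  refine (isUnit_T cs φ a⁻¹).mul_right_cancel ?_
  rw [bar_T_mul_T_inv, T_parabolic_mul cs hφI ha, mul_inv_cancel, T_one]

theorem T_conj_simple (hφI : ∀ i ∈ I, φ i = 0) {a : W} (ha : a ∈ parabolic cs I) (j : B) :
    T cs φ (a * cs.simple j * a⁻¹) = T cs φ a * T cs φ (cs.simple j) * T cs φ a⁻¹ := by
  rw [T_parabolic_mul cs hφI ha, T_mul_parabolic cs hφI _ (inv_mem ha)]

variable {Mt : CoxeterMatrix (tildeJ cs I)} (cst : CoxeterSystem Mt (tildeW cs I))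

/-- The standing hypotheses of the comparison of the Hecke algebras of `(W, S, φ)` and
`(W̃, J̃, φ̃)`, where the Coxeter system `(W̃, J̃)` is given by `cst`. -/
structure IsTildeSetup (φ : B → Γ) : Prop where
  isParameter : IsParameter cs φ
  not_isConj : ∀ i ∈ I, ∀ j ∉ I, ¬ IsConj (cs.simple i) (cs.simple j)
  eq_zero : ∀ i ∈ I, φ i = 0
  coe_simple : ∀ t, (cst.simple t : W) = t

namespace IsTildeSetup

variable {cs cst}

theorem isParameter_tilde (H : IsTildeSetup cs cst φ) : IsParameter cst (tildePhi cs I φ) :=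
  isParameter_tildePhi cs H.isParameter cst H.coe_simple

theorem isHeckeFamily_T_coe (H : IsTildeSetup cs cst φ) :
    IsHeckeFamily cst (tildePhi cs I φ) fun x : tildeW cs I => T cs φ (x : W) where
  map_one := T_one cs φ
  map_simple_mul t x hx := by
    obtain ⟨j, hj, a, ha, ht⟩ := t.2
    have hdesc : ¬ cs.IsLeftDescent (a⁻¹ * x) j := fun h =>
      hx (isLeftDescent_tilde cs cst H.not_isConj H.coe_simple hj (a := ⟨a, ha⟩) ht h)
    rw [Subgroup.coe_mul, H.coe_simple, ht, T_conj_simple cs H.eq_zero ha, mul_assoc,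
      T_parabolic_mul cs H.eq_zero (inv_mem ha), mul_assoc,
      (isHeckeFamily_T cs φ).map_simple_mul j _ hdesc, T_parabolic_mul cs H.eq_zero ha]
    simp only [mul_assoc]
  map_simple_sq t := by
    obtain ⟨j, -, a, ha, ht⟩ := t.2
    have hinv : T cs φ a⁻¹ * T cs φ a = 1 := by
      rw [T_parabolic_mul cs H.eq_zero (inv_mem ha), inv_mul_cancel, T_one]
    have hinv' : T cs φ a * T cs φ a⁻¹ = 1 := by
      rw [T_parabolic_mul cs H.eq_zero ha, mul_inv_cancel, T_one]
    have hcoeff : heckeCoeff (tildePhi cs I φ) t = heckeCoeff φ j := by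
      rw [heckeCoeff, heckeCoeff, tildePhi_eq cs I φ H.isParameter t j a ht]
    rw [H.coe_simple, ht, T_conj_simple cs H.eq_zero ha, hcoeff]
    calc T cs φ a * T cs φ (cs.simple j) * T cs φ a⁻¹ *
          (T cs φ a * T cs φ (cs.simple j) * T cs φ a⁻¹)
        = T cs φ a * (T cs φ (cs.simple j) * (T cs φ a⁻¹ * T cs φ a) * T cs φ (cs.simple j)) *
          T cs φ a⁻¹ := by simp only [mul_assoc]
      _ = _ := by
        rw [hinv, mul_one, (isHeckeFamily_T cs φ).map_simple_sq, mul_add, mul_one, add_mul, hinv',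
          mul_smul_comm, smul_mul_assoc]

end IsTildeSetup

variable {cs cst} (H : IsTildeSetup cs cst φ)

/-- The morphism `H(W̃, J̃, φ̃) → H(W, S, φ)`, `T_x ↦ T_x`. -/
def tildeHom : Hecke cst (tildePhi cs I φ) →ₐ[GroupRing Γ] Hecke cs φ :=
  heckeLift H.isHeckeFamily_T_coe

theorem tildeHom_T (x : tildeW cs I) :
    tildeHom H (T cst (tildePhi cs I φ) x) = T cs φ (x : W) :=
  heckeLift_T H.isHeckeFamily_T_coe x

theorem T_mul_tildeHom_T (a : parabolic cs I) (x : tildeW cs I) :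
    T cs φ (a : W) * tildeHom H (T cst (tildePhi cs I φ) x) = T cs φ ((a : W) * x) := by
  rw [tildeHom_T, T_parabolic_mul cs H.eq_zero a.2]

theorem bar_tildeHom (h : Hecke cst (tildePhi cs I φ)) :
    bar cs φ (tildeHom H h) = tildeHom H (bar cst (tildePhi cs I φ) h) := by
  induction h using hecke_induction with
  | T x =>
    refine (isUnit_T cs φ (x⁻¹ : tildeW cs I)).mul_right_cancel ?_
    conv_rhs => rw [← tildeHom_T H, ← map_mul, bar_T_mul_T_inv, map_one]
    rw [tildeHom_T, Subgroup.coe_inv, bar_T_mul_T_inv]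
  | add x y hx hy => simp only [map_add, hx, hy]
  | smul a x hx => rw [map_smul, bar_smul, bar_smul, map_smul, hx]

end TildeHecke

section TildeKL

variable {B W : Type*} [Group W] {M : CoxeterMatrix B} {cs : CoxeterSystem M W} {I : Set B}
variable {Γ : Type*} [AddCommGroup Γ] [LinearOrder Γ] {φ : B → Γ}
variable {Mt : CoxeterMatrix (tildeJ cs I)} {cst : CoxeterSystem Mt (tildeW cs I)}
variable (H : IsTildeSetup cs cst φ)

theorem T_mul_tildeHom_mem_heckeNeg (a : parabolic cs I)
    {h : Hecke cst (tildePhi cs I φ)} (hh : h ∈ heckeNeg cst (tildePhi cs I φ)) :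
    T cs φ (a : W) * tildeHom H h ∈ heckeNeg cs φ := by
  induction hh using AddSubgroup.closure_induction with
  | mem h hx =>
    obtain ⟨γ, hγ, x, rfl⟩ := hx
    rw [map_smul, mul_smul_comm, T_mul_tildeHom_T]
    exact AddSubgroup.subset_closure ⟨γ, hγ, _, rfl⟩
  | zero => simp
  | add x y _ _ hx hy => rw [map_add, mul_add]; exact add_mem hx hy
  | neg x _ hx => rw [map_neg, mul_neg]; exact neg_mem hx

variable [IsOrderedAddMonoid Γ]

theorem KL_parabolic_mul (a : parabolic cs I) (x : tildeW cs I) :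
    KL cs φ ((a : W) * x) = T cs φ (a : W) * tildeHom H (KL cst (tildePhi cs I φ) x) := by
  have h := isKL_KL H.isParameter_tilde x
  refine (IsKL.eq_KL H.isParameter ⟨?_, ?_⟩).symm
  · rw [map_mul, bar_T_parabolic cs H.eq_zero a.2, bar_tildeHom, h.1]
  · rw [← T_mul_tildeHom_T H, ← mul_sub, ← map_sub]
    exact T_mul_tildeHom_mem_heckeNeg H a h.2

theorem repr_T_mul_tildeHom (a : parabolic cs I) (h : Hecke cst (tildePhi cs I φ)) :
    (KLBasis H.isParameter).repr (T cs φ (a : W) * tildeHom H h) =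
      ((KLBasis H.isParameter_tilde).repr h).mapDomain
        fun x : tildeW cs I => (a : W) * x := by
  have hlin : (KLBasis H.isParameter).repr.toLinearMap ∘ₗ
        LinearMap.mulLeft (GroupRing Γ) (T cs φ (a : W)) ∘ₗ (tildeHom H).toLinearMap =
      Finsupp.lmapDomain _ _ (fun x : tildeW cs I => (a : W) * x) ∘ₗ
        (KLBasis H.isParameter_tilde).repr.toLinearMap := by
    refine (KLBasis H.isParameter_tilde).ext fun x => ?_
    simp only [LinearMap.comp_apply, LinearEquiv.coe_coe, Finsupp.lmapDomain_apply,
      AlgHom.toLinearMap_apply, LinearMap.mulLeft_apply]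
    rw [Module.Basis.repr_self, Finsupp.mapDomain_single, KLBasis_apply, ← KL_parabolic_mul,
      ← KLBasis_apply H.isParameter, Module.Basis.repr_self]
  exact LinearMap.congr_fun hlin h

end TildeKL

section CellModules

variable {B W : Type*} [Group W] {M : CoxeterMatrix B} {cs : CoxeterSystem M W}
variable {Γ : Type*} [AddCommGroup Γ] [LinearOrder Γ] [IsOrderedAddMonoid Γ] {φ : B → Γ}

theorem repr_linearCombination_KL (hφ : IsParameter cs φ) (a : W →₀ GroupRing Γ) :
    (KLBasis hφ).repr (a.sum fun z c => c • KL cs φ z) = a := by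
  simp_rw [← KLBasis_apply hφ]
  exact (KLBasis hφ).repr_linearCombination a

theorem leftArrow_of_repr_ne_zero (hφ : IsParameter cs φ) {x y : W} (h : Hecke cs φ)
    (hx : (KLBasis hφ).repr (h * KL cs φ y) x ≠ 0) : LeftArrow cs φ x y :=
  ⟨h, _, (KLBasis hφ).repr.injective (repr_linearCombination_KL hφ _).symm, hx⟩

theorem leftArrow_iff (hφ : IsParameter cs φ) {x y : W} :
    LeftArrow cs φ x y ↔ ∃ w, (KLBasis hφ).repr (T cs φ w * KL cs φ y) x ≠ 0 := by
  refine ⟨?_, fun ⟨w, hw⟩ => leftArrow_of_repr_ne_zero hφ _ hw⟩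
  rintro ⟨h, a, ha, hx⟩
  rw [← repr_linearCombination_KL hφ a, ← ha] at hx
  contrapose! hx
  clear ha
  induction h using hecke_induction with
  | T w => exact hx w
  | add h h' hh hh' => rw [add_mul, map_add, Finsupp.add_apply, hh, hh', add_zero]
  | smul r h hh => rw [smul_mul_assoc, map_smul, Finsupp.smul_apply, hh, smul_zero]

theorem leftArrow_refl (hφ : IsParameter cs φ) (x : W) : LeftArrow cs φ x x := by
  refine leftArrow_of_repr_ne_zero hφ 1 ?_
  rw [one_mul, ← KLBasis_apply hφ, Module.Basis.repr_self, Finsupp.single_eq_same]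
  exact one_ne_zero

theorem leftLE_refl (hφ : IsParameter cs φ) (x : W) : LeftLE cs φ x x :=
  .single (leftArrow_refl hφ x)

theorem mem_span_KL_image_iff (hφ : IsParameter cs φ) {X : Set W}
    (hX : ∀ z w, LeftArrow cs φ z w → w ∈ X → z ∈ X) {h : Hecke cs φ} :
    h ∈ Submodule.span (Hecke cs φ) (KL cs φ '' X) ↔ ↑((KLBasis hφ).repr h).support ⊆ X := by
  have hKL : ⇑(KLBasis hφ) = KL cs φ := funext (KLBasis_apply hφ)
  rw [← Module.Basis.mem_span_image, hKL]
  refine ⟨fun hh => ?_, fun hh => Submodule.span_le_restrictScalars (GroupRing Γ) _ _ hh⟩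
  induction hh using Submodule.span_induction with
  | mem x hx => exact Submodule.subset_span hx
  | zero => exact zero_mem _
  | add x y _ _ hx hy => exact add_mem hx hy
  | smul a x _ hx =>
    have hle : Submodule.span (GroupRing Γ) (KL cs φ '' X) ≤
        (Submodule.span (GroupRing Γ) (KL cs φ '' X)).comap (LinearMap.mulLeft _ a) := by
      rw [Submodule.span_le]
      rintro - ⟨w, hw, rfl⟩
      rw [SetLike.mem_coe, Submodule.mem_comap, ← hKL, Module.Basis.mem_span_image]
      intro z hz
      refine hX z w (leftArrow_of_repr_ne_zero hφ a ?_) hw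
      rw [← KLBasis_apply hφ]
      exact Finsupp.mem_support_iff.1 hz
    exact hle hx

variable (cs φ) in
/-- The set of the elements `w` with `w ≤_L C`. -/
def leftLower (C : Set W) : Set W := {w | ∃ c ∈ C, LeftLE cs φ w c}

theorem subset_leftLower (hφ : IsParameter cs φ) (C : Set W) : C ⊆ leftLower cs φ C :=
  fun c hc => ⟨c, hc, leftLE_refl hφ c⟩

theorem mem_idealLE_iff (hφ : IsParameter cs φ) {C : Set W} {h : Hecke cs φ} :
    h ∈ idealLE cs φ C ↔ ↑((KLBasis hφ).repr h).support ⊆ leftLower cs φ C := by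
  rw [← mem_span_KL_image_iff hφ]
  · simp only [idealLE, leftLower, Set.image, Set.mem_ofPred_eq, eq_comm]
  · rintro z w hzw ⟨c, hc, hw⟩
    exact ⟨c, hc, .head hzw hw⟩

theorem mem_idealLT_iff (hφ : IsParameter cs φ) {C : Set W} (hC : IsLeftCell cs φ C)
    {h : Hecke cs φ} :
    h ∈ idealLT cs φ C ↔ ↑((KLBasis hφ).repr h).support ⊆ leftLower cs φ C \ C := by
  rw [← mem_span_KL_image_iff hφ]
  · simp only [idealLT, leftLower, Set.image, Set.mem_sdiff, Set.mem_ofPred_eq, eq_comm]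
  · obtain ⟨v, rfl⟩ := hC
    rintro z w hzw ⟨⟨c, hc, hw⟩, hwv⟩
    exact ⟨⟨c, hc, .head hzw hw⟩, fun hz => hwv ⟨hw.trans hc.1, hz.2.trans (.single hzw)⟩⟩

theorem KL_mem_idealLE (hφ : IsParameter cs φ) {C : Set W} (c : C) :
    KL cs φ c ∈ idealLE cs φ C :=
  Submodule.subset_span ⟨c, subset_leftLower hφ C c.2, rfl⟩

/-- The map that sends an element of `H_{≤ C}` to its coefficients on the `C_w` with `w ∈ C`. -/
def cellCoord (hφ : IsParameter cs φ) (C : Set W) :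
    idealLE cs φ C →ₗ[GroupRing Γ] C →₀ GroupRing Γ :=
  Finsupp.lsubtypeDomain C ∘ₗ (KLBasis hφ).repr.toLinearMap ∘ₗ
    (idealLE cs φ C).subtype.restrictScalars (GroupRing Γ)

theorem cellCoord_apply (hφ : IsParameter cs φ) {C : Set W} (h : idealLE cs φ C) (c : C) :
    cellCoord hφ C h c = (KLBasis hφ).repr (h : Hecke cs φ) c := rfl

theorem cellCoord_surjective (hφ : IsParameter cs φ) (C : Set W) :
    Function.Surjective (cellCoord hφ C) := by
  classical
  intro a
  have ha : ↑(a.extendDomain).support ⊆ leftLower cs φ C :=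
    (Finsupp.support_extendDomain_subset a).trans (subset_leftLower hφ C)
  refine ⟨⟨(KLBasis hφ).repr.symm a.extendDomain, (mem_idealLE_iff hφ).2 ?_⟩, ?_⟩
  · rwa [LinearEquiv.apply_symm_apply]
  · refine Finsupp.ext fun c => ?_
    rw [cellCoord_apply, LinearEquiv.apply_symm_apply]
    exact DFunLike.congr_fun (Finsupp.subtypeDomain_extendDomain a) c

theorem ker_cellCoord (hφ : IsParameter cs φ) {C : Set W} (hC : IsLeftCell cs φ C) :
    ((idealLT cs φ C).submoduleOf (idealLE cs φ C)).restrictScalars (GroupRing Γ) =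
      LinearMap.ker (cellCoord hφ C) := by
  ext ⟨h, hh⟩
  have hle := (mem_idealLE_iff hφ).1 hh
  calc h ∈ idealLT cs φ C ↔ ∀ c ∈ C, (KLBasis hφ).repr h c = 0 := by
        rw [mem_idealLT_iff hφ hC, Set.subset_sdiff, and_iff_right hle, Set.disjoint_right]
        simp only [SetLike.mem_coe, Finsupp.notMem_support_iff]
    _ ↔ _ := by
        rw [LinearMap.mem_ker, Finsupp.ext_iff]
        simp only [cellCoord_apply, Subtype.forall, Finsupp.coe_zero, Pi.zero_apply]

/-- The basis of the cell module of `C` that consists of the classes of the `C_w` with `w ∈ C`. -/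
def cellBasis (hφ : IsParameter cs φ) {C : Set W} (hC : IsLeftCell cs φ C) :
    Module.Basis C (GroupRing Γ) (CellModule cs φ C) :=
  .ofRepr <| (Submodule.Quotient.restrictScalarsEquiv (GroupRing Γ) _).symm ≪≫ₗ
    Submodule.quotEquivOfEq _ _ (ker_cellCoord hφ hC) ≪≫ₗ
    (cellCoord hφ C).quotKerEquivOfSurjective (cellCoord_surjective hφ C)

theorem cellBasis_apply (hφ : IsParameter cs φ) {C : Set W} (hC : IsLeftCell cs φ C) (c : C) :
    cellBasis hφ hC c = Submodule.Quotient.mk ⟨KL cs φ c, KL_mem_idealLE hφ c⟩ := by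
  classical
  rw [cellBasis, Module.Basis.coe_ofRepr, LinearEquiv.symm_apply_eq]
  refine Finsupp.ext fun d => ?_
  calc Finsupp.single c (1 : GroupRing Γ) d = Finsupp.single (c : W) 1 (d : W) := by
        simp only [Finsupp.single_apply, Subtype.ext_iff]
    _ = (KLBasis hφ).repr (KL cs φ c) d := by
        rw [← KLBasis_apply hφ, Module.Basis.repr_self]

end CellModules

section SpecBasis

variable {Γ : Type*} [AddCommGroup Γ] {V : Type*} [AddCommGroup V] [Module (GroupRing Γ) V]
variable {ι : Type*} (b : Module.Basis ι (GroupRing Γ) V)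

variable (Γ) in
/-- The identity map from `ℤ`, regarded as a `ℤ[Γ]`-module through `e^γ ↦ 1`, to the plain additive
group `ℤ`. -/
def augIntEquiv : AugInt Γ ≃+ ℤ := .refl ℤ

open Classical in
/-- The basis `1 ⊗ b i` of `ℤ ⊗_{ℤ[Γ]} V` that comes from a `ℤ[Γ]`-basis `b` of `V`. -/
def specBasis : Module.Basis ι ℤ (AugInt Γ ⊗[GroupRing Γ] V) :=
  .ofRepr ((TensorProduct.equivFinsuppOfBasisRight b).toAddEquiv.trans
    (Finsupp.mapRange.addEquiv (augIntEquiv Γ))).toIntLinearEquiv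

theorem specBasis_apply (i : ι) :
    specBasis b i = (augIntEquiv Γ).symm 1 ⊗ₜ b i := by
  classical
  rw [specBasis, Module.Basis.coe_ofRepr, LinearEquiv.symm_apply_eq]
  refine Finsupp.ext fun j => ?_
  change Finsupp.single i 1 j = augIntEquiv Γ (TensorProduct.equivFinsuppOfBasisRight b _ j)
  rw [TensorProduct.equivFinsuppOfBasisRight_apply_tmul_apply, Module.Basis.repr_self]
  simp only [Finsupp.single_apply]
  split_ifs
  · rw [one_smul, AddEquiv.apply_symm_apply]
  · rw [zero_smul, map_zero]

end SpecBasis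

section InducedRepresentations

open Representation

variable {k G H A V : Type*} [CommRing k] [Group G] [Group H] [AddCommGroup A] [Module k A]
  [AddCommGroup V] [Module k V] {ψ : G →* H} {ρ : Representation k G A} {τ : Representation k H V}

theorem indV_mk_map_mul (g : G) (h : H) (a : A) :
    IndV.mk ψ ρ (ψ g * h) (ρ g a) = IndV.mk ψ ρ h a := by
  simpa using
    Coinvariants.mk_self_apply (ρ := .tprod ((leftRegular k H).comp ψ) ρ) g (.single h 1 ⊗ₜ a)

/-- Frobenius reciprocity: the map from the induced representation that corresponds to a
`G`-equivariant map `f`. -/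
def indLift (f : ρ.IntertwiningMap (τ.comp ψ)) : (ind ψ ρ).IntertwiningMap τ where
  toLinearMap := Coinvariants.lift _
    (TensorProduct.lift <| (Finsupp.lift _ _ _ fun h => τ h⁻¹ ∘ₗ f.toLinearMap) ∘ₗ
      (MonoidAlgebra.coeffLinearEquiv k).toLinearMap)
    fun g => by
      ext h x
      simp [mul_inv_rev, f.isIntertwining]
  isIntertwining' h := by ext; simp

theorem indLift_mk (f : ρ.IntertwiningMap (τ.comp ψ)) (h : H) (a : A) :
    indLift f (IndV.mk ψ ρ h a) = τ h⁻¹ (f a) := by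
  simp [indLift]

theorem indLift_bijective {ι κ : Type*} (f : ρ.IntertwiningMap (τ.comp ψ)) (r : κ → H)
    (hr : ∀ h, ∃ i g, h = r i * ψ g) (b : Module.Basis ι k A) (b' : Module.Basis (κ × ι) k V)
    (hb' : ∀ i j, b' (i, j) = τ (r i) (f (b j))) : Function.Bijective (indLift f) := by
  let e : V →ₗ[k] IndV ψ ρ := b'.constr k fun p => IndV.mk ψ ρ (r p.1)⁻¹ (b p.2)
  have indLift_mk_inv (i : κ) (j : ι) : indLift f (IndV.mk ψ ρ (r i)⁻¹ (b j)) = b' (i, j) := by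
    rw [indLift_mk, inv_inv, hb']
  have e_basis (i : κ) (j : ι) : e (b' (i, j)) = IndV.mk ψ ρ (r i)⁻¹ (b j) :=
    b'.constr_basis k _ _
  have e_mk_inv (i : κ) : (e ∘ₗ (indLift f).toLinearMap) ∘ₗ IndV.mk ψ ρ (r i)⁻¹ =
      IndV.mk ψ ρ (r i)⁻¹ :=
    b.ext fun j => (congrArg e (indLift_mk_inv i j)).trans (e_basis i j)
  have h_left : e ∘ₗ (indLift f).toLinearMap = .id := by
    refine IndV.hom_ext _ _ fun h => LinearMap.ext fun a => ?_
    obtain ⟨i, g, hi⟩ := hr h⁻¹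
    have hg : h = ψ g⁻¹ * (r i)⁻¹ := by rw [map_inv, ← mul_inv_rev, ← hi, inv_inv]
    have h_mk : IndV.mk ψ ρ h a = IndV.mk ψ ρ (r i)⁻¹ (ρ g a) := by
      rw [hg, ← indV_mk_map_mul g⁻¹ (r i)⁻¹, ρ.inv_self_apply]
    rw [LinearMap.comp_apply, LinearMap.id_comp, h_mk]
    exact LinearMap.congr_fun (e_mk_inv i) (ρ g a)
  have h_right : (indLift f).toLinearMap ∘ₗ e = .id := b'.ext fun ⟨i, j⟩ =>
    (congrArg (indLift f) (e_basis i j)).trans (indLift_mk_inv i j)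
  exact Function.bijective_iff_has_inverse.2
    ⟨e, LinearMap.congr_fun h_left, LinearMap.congr_fun h_right⟩

end InducedRepresentations

section TildeCells

variable {B W : Type*} [Group W] {M : CoxeterMatrix B} {cs : CoxeterSystem M W} {I : Set B}
variable {Γ : Type*} [AddCommGroup Γ] [LinearOrder Γ] [IsOrderedAddMonoid Γ] {φ : B → Γ}
variable {Mt : CoxeterMatrix (tildeJ cs I)} {cst : CoxeterSystem Mt (tildeW cs I)}

theorem mem_parabolic_mul_iff (hI : ∀ i ∈ I, ∀ j ∉ I, ¬ IsConj (cs.simple i) (cs.simple j))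
    {C : Set (tildeW cs I)} {w : W} :
    w ∈ (parabolic cs I : Set W) * ((↑) '' C : Set W) ↔ tildePart cs hI w ∈ C := by
  constructor
  · rintro ⟨a, ha, -, ⟨x, hx, rfl⟩, rfl⟩
    exact (tildePart_mul cs hI ⟨a, ha⟩ x).symm ▸ hx
  · intro hw
    obtain ⟨a, ha⟩ := exists_eq_mul_tildePart cs hI w
    rw [ha]
    exact Set.mul_mem_mul a.2 ⟨_, hw, rfl⟩

theorem T_mul_KL (H : IsTildeSetup cs cst φ) {w : W} {a b : parabolic cs I} {x y : tildeW cs I}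
    (h : w * a = b * y) :
    T cs φ w * KL cs φ (a * x) = T cs φ (b : W) *
      tildeHom H (T cst (tildePhi cs I φ) y * KL cst (tildePhi cs I φ) x) := by
  rw [KL_parabolic_mul H, ← mul_assoc, T_mul_parabolic cs H.eq_zero w a.2, h, map_mul,
    ← mul_assoc, T_mul_tildeHom_T H]

theorem leftArrow_mul_iff (H : IsTildeSetup cs cst φ) (a b : parabolic cs I) (x y : tildeW cs I) :
    LeftArrow cs φ (b * y) (a * x) ↔ LeftArrow cst (tildePhi cs I φ) y x := by
  classical
  rw [leftArrow_iff H.isParameter, leftArrow_iff H.isParameter_tilde]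
  constructor
  · rintro ⟨v, hv⟩
    obtain ⟨c, hc⟩ := exists_eq_mul_tildePart cs H.not_isConj (v * a)
    refine ⟨tildePart cs H.not_isConj (v * a), ?_⟩
    rw [T_mul_KL H hc, repr_T_mul_tildeHom H, ← Finsupp.mem_support_iff] at hv
    obtain ⟨z, hz, hzy⟩ := Finset.mem_image.1 (Finsupp.mapDomain_support hv)
    have h_eq : (c, z) = (b, y) := parabolic_mul_injective cs H.not_isConj hzy
    obtain rfl := congrArg Prod.snd h_eq
    exact Finsupp.mem_support_iff.1 hz
  · rintro ⟨z, hz⟩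
    refine ⟨b * z * (a : W)⁻¹, ?_⟩
    rw [T_mul_KL H (inv_mul_cancel_right _ _), repr_T_mul_tildeHom H]
    have h_inj : Function.Injective fun x : tildeW cs I => (b : W) * x :=
      (mul_right_injective _).comp Subtype.val_injective
    exact (Finsupp.mapDomain_apply h_inj _ _).trans_ne hz

theorem leftArrow_tildePart_iff (H : IsTildeSetup cs cst φ) {w w' : W} :
    LeftArrow cst (tildePhi cs I φ) (tildePart cs H.not_isConj w) (tildePart cs H.not_isConj w') ↔
      LeftArrow cs φ w w' := by
  obtain ⟨a, ha⟩ := exists_eq_mul_tildePart cs H.not_isConj w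
  obtain ⟨a', ha'⟩ := exists_eq_mul_tildePart cs H.not_isConj w'
  conv_rhs => rw [ha, ha']
  exact (leftArrow_mul_iff H a' a _ _).symm

theorem leftLE_tildePart_iff (H : IsTildeSetup cs cst φ) {w w' : W} :
    LeftLE cst (tildePhi cs I φ) (tildePart cs H.not_isConj w) (tildePart cs H.not_isConj w') ↔
      LeftLE cs φ w w' := by
  constructor
  · intro h
    obtain ⟨a, ha⟩ := exists_eq_mul_tildePart cs H.not_isConj w
    have h_mul : LeftLE cs φ w (a * tildePart cs H.not_isConj w') := by
      conv in w => rw [ha]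
      exact Relation.TransGen.lift _ (fun x y => (leftArrow_mul_iff H a a y x).2) _ _ h
    refine h_mul.tail ((leftArrow_tildePart_iff H).1 ?_)
    rw [tildePart_mul]
    exact leftArrow_refl H.isParameter_tilde _
  · exact Relation.TransGen.lift (tildePart cs H.not_isConj)
      (fun _ _ => (leftArrow_tildePart_iff H).2) w w'

theorem isLeftCell_parabolic_mul (H : IsTildeSetup cs cst φ) {C : Set (tildeW cs I)}
    (hC : IsLeftCell cst (tildePhi cs I φ) C) :
    IsLeftCell cs φ ((parabolic cs I : Set W) * ((↑) '' C : Set W)) := by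
  obtain ⟨x, rfl⟩ := hC
  refine ⟨x, Set.ext fun w => ?_⟩
  rw [mem_parabolic_mul_iff H.not_isConj]
  have hx := tildePart_coe cs H.not_isConj x
  simp only [Set.mem_ofPred_eq, LeftEquiv, ← leftLE_tildePart_iff H, hx]

variable (H : IsTildeSetup cs cst φ)

theorem tildeHom_KL (x : tildeW cs I) :
    tildeHom H (KL cst (tildePhi cs I φ) x) = KL cs φ (x : W) := by
  simpa only [Subgroup.coe_one, one_mul, T_one] using (KL_parabolic_mul H 1 x).symm

theorem idealLE_le_comap (C : Set (tildeW cs I)) :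
    idealLE cst (tildePhi cs I φ) C ≤
      (idealLE cs φ ((parabolic cs I : Set W) * ((↑) '' C : Set W))).comap
        (tildeHom H).toRingHom.toSemilinearMap := by
  refine Submodule.span_le.2 ?_
  rintro - ⟨x, ⟨c, hc, hx⟩, rfl⟩
  refine Submodule.subset_span ⟨x, ⟨c, ?_, ?_⟩, tildeHom_KL H x⟩
  · rwa [mem_parabolic_mul_iff H.not_isConj, tildePart_coe]
  · rwa [← leftLE_tildePart_iff H, tildePart_coe, tildePart_coe]

theorem idealLT_le_comap (C : Set (tildeW cs I)) :
    idealLT cst (tildePhi cs I φ) C ≤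
      (idealLT cs φ ((parabolic cs I : Set W) * ((↑) '' C : Set W))).comap
        (tildeHom H).toRingHom.toSemilinearMap := by
  refine Submodule.span_le.2 ?_
  rintro - ⟨x, ⟨⟨c, hc, hx⟩, hxC⟩, rfl⟩
  refine Submodule.subset_span ⟨x, ⟨⟨c, ?_, ?_⟩, ?_⟩, tildeHom_KL H x⟩
  · rwa [mem_parabolic_mul_iff H.not_isConj, tildePart_coe]
  · rwa [← leftLE_tildePart_iff H, tildePart_coe, tildePart_coe]
  · rwa [mem_parabolic_mul_iff H.not_isConj, tildePart_coe]

/-- The map `M_C → M_{W_I · C}` of cell modules that is induced by `tildeHom`. -/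
def cellMap (C : Set (tildeW cs I)) :
    CellModule cst (tildePhi cs I φ) C →ₛₗ[(tildeHom H).toRingHom]
      CellModule cs φ ((parabolic cs I : Set W) * ((↑) '' C : Set W)) :=
  Submodule.mapQ _ _ ((tildeHom H).toRingHom.toSemilinearMap.restrict (idealLE_le_comap H C))
    fun _ hx => idealLT_le_comap H C hx

/-- `cellMap` as a `ℤ[Γ]`-linear map. -/
def cellMapLinear (C : Set (tildeW cs I)) :
    CellModule cst (tildePhi cs I φ) C →ₗ[GroupRing Γ]
      CellModule cs φ ((parabolic cs I : Set W) * ((↑) '' C : Set W)) where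
  __ := cellMap H C
  map_smul' a m := by
    rw [← algebraMap_smul (Hecke cst (tildePhi cs I φ)) a m]
    exact (LinearMap.map_smulₛₗ _ _ _).trans
      ((congrArg (· • _) ((tildeHom H).commutes a)).trans (algebraMap_smul _ _ _))

/-- The map `ℤ M_C → ℤ M_{W_I · C}` that is induced by `tildeHom`. -/
def specCellMap (C : Set (tildeW cs I)) :
    (cellRep cst (tildePhi cs I φ) C).IntertwiningMap
      ((cellRep cs φ ((parabolic cs I : Set W) * ((↑) '' C : Set W))).comp
        (tildeW cs I).subtype) where
  toLinearMap := ((cellMapLinear H C).lTensor (AugInt Γ)).toAddMonoidHom.toIntLinearMap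
  isIntertwining' x := by
    refine LinearMap.ext fun v => ?_
    induction v with
    | zero => simp only [map_zero]
    | add u v hu hv => rw [map_add, map_add, hu, hv]
    | tmul n m =>
      have h : cellMap H C (T cst (tildePhi cs I φ) x • m) = T cs φ (x : W) • cellMap H C m :=
        (LinearMap.map_smulₛₗ _ _ _).trans (congrArg (· • cellMap H C m) (tildeHom_T H x))
      exact congrArg (n ⊗ₜ ·) h

theorem cellRep_specCellMap_specBasis {C : Set (tildeW cs I)}
    (hC : IsLeftCell cst (tildePhi cs I φ) C) (a : parabolic cs I) (x : C) :
    cellRep cs φ _ (a : W) (specCellMap H C (specBasis (cellBasis H.isParameter_tilde hC) x)) =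
      specBasis (cellBasis H.isParameter (isLeftCell_parabolic_mul H hC))
        ⟨a * (x : tildeW cs I), Set.mul_mem_mul a.2 ⟨x, x.2, rfl⟩⟩ := by
  have h : T cs φ (a : W) • cellMap H C (cellBasis H.isParameter_tilde hC x) =
      cellBasis H.isParameter (isLeftCell_parabolic_mul H hC)
        ⟨a * (x : tildeW cs I), Set.mul_mem_mul a.2 ⟨x, x.2, rfl⟩⟩ := by
    rw [cellBasis_apply, cellBasis_apply]
    exact congrArg Submodule.Quotient.mk (Subtype.ext (KL_parabolic_mul H a x).symm)
  rw [specBasis_apply, specBasis_apply, ← h]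
  rfl

/-- The bijection `(a, x) ↦ a x` from `W_I × C` to `W_I · C`. -/
def parabolicProdEquiv (hI : ∀ i ∈ I, ∀ j ∉ I, ¬ IsConj (cs.simple i) (cs.simple j))
    (C : Set (tildeW cs I)) :
    parabolic cs I × C ≃ ((parabolic cs I : Set W) * ((↑) '' C : Set W) : Set W) :=
  .ofBijective (fun p => ⟨p.1 * (p.2 : tildeW cs I), Set.mul_mem_mul p.1.2 ⟨p.2, p.2.2, rfl⟩⟩) <| by
    constructor
    · rintro ⟨a, x, hx⟩ ⟨b, y, hy⟩ h
      have h_eq : (a, x) = (b, y) := parabolic_mul_injective cs hI (Subtype.ext_iff.1 h)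
      cases h_eq
      rfl
    · rintro ⟨-, a, ha, -, ⟨x, hx, rfl⟩, rfl⟩
      exact ⟨(⟨a, ha⟩, ⟨x, hx⟩), rfl⟩

/-- The isomorphism `ℤ M_{W_I · C} ≃ Ind ℤ M_C`, under which the class of `C_{a x}` corresponds to
`a ⊗ C_x`. -/
def cellRepEquivInd {C : Set (tildeW cs I)} (hC : IsLeftCell cst (tildePhi cs I φ) C) :
    (cellRep cs φ ((parabolic cs I : Set W) * ((↑) '' C : Set W))).Equiv
      (Representation.ind (tildeW cs I).subtype (cellRep cst (tildePhi cs I φ) C)) :=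
  ((indLift (specCellMap H C)).ofBijective <|
    indLift_bijective (specCellMap H C) (fun a : parabolic cs I => (a : W))
      (fun w => (exists_eq_mul_tildePart cs H.not_isConj w).imp fun _ h => ⟨_, h⟩)
      (specBasis (cellBasis H.isParameter_tilde hC))
      ((specBasis (cellBasis H.isParameter (isLeftCell_parabolic_mul H hC))).reindex
        (parabolicProdEquiv H.not_isConj C).symm)
      fun a x => by
        rw [Module.Basis.reindex_apply, Equiv.symm_symm]
        exact (cellRep_specCellMap_specBasis H hC a x).symm).symm

end TildeCells

end KLCells

end

theorem mainTheorem11 {B W : Type*} [Group W] {M : CoxeterMatrix B} (cs : CoxeterSystem M W)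
    {Γ : Type*} [AddCommGroup Γ] [LinearOrder Γ] [IsOrderedAddMonoid Γ]
    (φ : B → Γ) (hφ : KLCells.IsParameter cs φ)
    (I : Set B) (hI : ∀ i ∈ I, ∀ j ∉ I, ¬ IsConj (cs.simple i) (cs.simple j))
    (hφI : ∀ i ∈ I, φ i = 0) :
    ∃ (Mt : CoxeterMatrix (KLCells.tildeJ cs I))
      (cst : CoxeterSystem Mt (KLCells.tildeW cs I)),
      (∀ t : KLCells.tildeJ cs I, (cst.simple t : W) = t) ∧
      KLCells.IsParameter cst (KLCells.tildePhi cs I φ) ∧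
      ∀ C : Set (KLCells.tildeW cs I),
        KLCells.IsLeftCell cst (KLCells.tildePhi cs I φ) C →
          KLCells.IsLeftCell cs φ
            ((KLCells.parabolic cs I : Set W) * ((↑) '' C : Set W)) ∧
          Nonempty ((KLCells.cellRep cs φ
              ((KLCells.parabolic cs I : Set W) * ((↑) '' C : Set W))).Equiv
            (Representation.ind (KLCells.tildeW cs I).subtype
              (KLCells.cellRep cst (KLCells.tildePhi cs I φ) C))) := by
  have H : KLCells.IsTildeSetup cs (KLCells.tildeSystem cs hI) φ :=
    ⟨hφ, hI, hφI, KLCells.coe_tildeSystem_simple cs hI⟩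
  exact ⟨_, KLCells.tildeSystem cs hI, H.coe_simple, H.isParameter_tilde, fun C hC =>
    ⟨KLCells.isLeftCell_parabolic_mul H hC, ⟨KLCells.cellRepEquivInd H hC⟩⟩⟩
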